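/- **Setting.** Let $K$ be a fixed number of items, $\mathcal N=\mathbb R^{\binom K2}$ the space of preference profiles $\nu=(\nu_{ij})_{i<j}$ with the Euclidean inner product, $\mathcal L=\{(\mu_i-\mu_j)_{i<j}:\mu\in\mathbb R^K\}$ and $\mathcal C=\mathcal L^\perp$; $\nu_{\rm cyclic}$ is the orthogonal projection of $\nu$ on $\mathcal C$. For a triad $i<j<k$ let $c_{(i,j,k)}\in\mathcal C$ be the vector with coordinates $1,1,-1$ at the pairs $(i,j),(j,k),(i,k)$ and $0$ elsewhere. A *minimal model* of $\nu$ is a vector $\gamma$ with $\nu_{\rm cyclic}=\sum\gamma_{ijk}c_{(i,j,k)}$ and the least possible number of non-zero coefficients; its triads are those with $\gamma_{ijk}\neq0$. The true model $\mathcal S$ is the smallest subspace containing $\mathcal L$ and the vectors $c_{(i,j,k)}$ of the triads of all minimal models. For a profile $v$, a triad has as many ticks (0 to 3) as there are pairs in it at which $v$ is non-zero. **Data.** For each pair $i<j$ one observes $Y_{ijk}=\nu_{ij}+\epsilon_{ijk}$, $k=1,\dots,n_{ij}$, where the $\epsilon_{ijk}$ are i.i.d. with mean $0$ and variance $\sigma^2\in(0,\infty)$;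 $n=\sum_{i<j}n_{ij}$, $\bar S_{ij}$ is the average of the $Y_{ijk}$, $\hat\nu=(\bar S_{ij})$, $\hat\nu_{\rm cyclic}$ its projection on $\mathcal C$, $\hat\sigma^2=\frac1n\sum_{i<j}\sum_k(Y_{ijk}-\hat\nu_{ij})^2$, $D={\rm diag}(n_{ij})$, $\Xi=D/n$. **Algorithm FTBS at level $\alpha\in(0,1)$.** (1) Let $\alpha^*_{ij}$ be the two-sided normal p-value of $\hat\nu_{{\rm cyclic},ij}/\hat\sigma_{{\rm cyclic},ij}$, where $\hat\sigma^2_{{\rm cyclic},ij}$ is the $(ij,ij)$ entry of $\hat\sigma^2\,\Pi D^{-1}\Pi^\top$ and $\Pi$ is the projection matrix on $\mathcal C$. Reject $H_0^{(i,j)}:\nu_{{\rm cyclic},ij}=0$ by one fixed rule among: Bonferroni ($\alpha^*_{ij}<\alpha/\binom K2$); ranked thresholds ($\alpha^*_{ij}<\alpha r_{ij}/\binom K2$, where $r_{ij}$ is the number of p-values that are at most $\alpha^*_{ij}$); the step-up version of the latter (reject every pair whose p-value is at most some p-value lying below its ranked threshold). Let $\nu^*_{\rm cyclic}$ be $\hat\nu_{\rm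 cyclic}$ with the coordinates that are not rejected set to $0$. (2) Let $\mathcal C_a^*$ be the set of triads with exactly $a$ ticks for $\nu^*_{\rm cyclic}$ and $\mathcal C^*_{a,\rm lin}$ a maximal linearly independent subset (chosen by any fixed rule). Let $\mathcal C^{*+}_{2,\rm lin}$ be the elements of $\mathcal C^*_{2,\rm lin}$ not in the span of $\mathcal C^*_{3,\rm lin}$, and $\mathcal C^{*+}_{1,\rm lin}$ the elements of $\mathcal C^*_{1,\rm lin}$ not in the span of $\mathcal C^*_{3,\rm lin}\cup\mathcal C^{*+}_{2,\rm lin}$. The candidates are $\mathcal S_1^*=\mathcal L$, $\mathcal S_2^*=\mathcal L\cup\mathcal C^*_{3,\rm lin}$, $\mathcal S_3^*=\mathcal S_2^*\cup\mathcal C^{*+}_{2,\rm lin}$, $\mathcal S_4^*=\mathcal S_3^*\cup\mathcal C^{*+}_{1,\rm lin}$. (3) $\widehat{\mathcal S}$ is the first $\mathcal S^*_a$, $a\le3$, whose lack-of-fit test does not reject, and $\mathcal S_4^*$ if all three reject. The lack-of-fit test of $\nu\in S$ rejects when $\mathbb P(\sum_e\lambda_eZ_e^2\ge R_{n,S})\le\alpha$,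 where $R_{n,S}=\sum_{i<j}n_{ij}(\bar S_{ij}-\hat\nu_{S,ij})^2$, $\hat\nu_S$ is the least squares estimator of $\nu$ in $S$, the $Z_e$ are independent standard normal, and the $\lambda_e$ are the eigenvalues of $\hat\sigma^2\,\Xi^{1/2}M\,\Xi^{-1}M^\top\Xi^{1/2}$, with $Mv=v-{}$(the $\Xi$-weighted least squares fit of $v$ in $S$). **Theorem.** Consider a sequence of designs with $n_{ij}\to\infty$ for all $i<j$. 1. For fixed $\alpha\in(0,1)$, $\mathbb P(\nu_{\rm cyclic}\in{\rm span}(\widehat{\mathcal S}))\to1$. 2. For fixed $\alpha\in(0,1)$, if moreover all $n_{ij}$ are of exact order $n$ (there is $c>0$ with $n_{ij}\ge cn$ eventually, for all $i<j$) and the errors are sub-Gaussian, then there are constants $C_1,C_2>0$, not depending on the position in the sequence, with $\mathbb P(\nu_{\rm cyclic}\in{\rm span}(\widehat{\mathcal S}))\ge1-C_1e^{-C_2n}$. 3. Let FTBS be run at levels $\alpha_n\in(0,1)$ with $\alpha_n\to0$. Suppose that at these levels the power tends to $1$ for each test of a false null hypothesis, that is, for the test of $\nu_{{\rm cyclic},ij}=0$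 whenever $\nu_{{\rm cyclic},ij}\ne0$, and for the lack-of-fit test of the model spanned by $\mathcal L$ and any set of triads whenever $\nu$ is not in that model. Suppose further that $\nu$ has a minimal model such that any two of its triads share at most one index, and such that every triad each of whose three pairs is contained in a triad of the minimal model is itself a triad of the minimal model. Then, with probability tending to $1$, ${\rm span}(\widehat{\mathcal S})=\mathcal S$ and the selected triads are exactly those of the minimal model. -/

import Mathlib

open MeasureTheory ProbabilityTheory Filter Topology
open scoped NNReal Matrix

noncomputable section

namespace PairedComparison

/-! ### Pairs, triads and the parameter space -/

/-- The pairs `(i, j)` with `i < j` of the `K` items. -/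
abbrev Pair (K : ℕ) : Type := {p : Fin K × Fin K // p.1 < p.2}

/-- The triads `(i, j, k)` with `i < j < k` of the `K` items. -/
abbrev Triad (K : ℕ) : Type :=
  {t : Fin K × Fin K × Fin K // t.1 < t.2.1 ∧ t.2.1 < t.2.2}

/-- The parameter space of preference profiles, one coordinate for each pair `i < j`,
with the Euclidean inner product. -/
abbrev Profile (K : ℕ) : Type := EuclideanSpace ℝ (Pair K)

variable {K : ℕ}

/-- The three pairs `(i, j)`, `(i, k)`, `(j, k)` that occur in the triad `(i, j, k)`. -/
def Triad.pairs (t : Triad K) : Finset (Pair K) :=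
  {⟨(t.1.1, t.1.2.1), t.2.1⟩, ⟨(t.1.1, t.1.2.2), t.2.1.trans t.2.2⟩,
    ⟨(t.1.2.1, t.1.2.2), t.2.2⟩}

/-- The three items of a triad. -/
def Triad.items (t : Triad K) : Finset (Fin K) := {t.1.1, t.1.2.1, t.1.2.2}

/-- The vector `b_k`, with `(s, t)` coordinate `𝟙(s = k) - 𝟙(t = k)`. -/
def itemVec (k : Fin K) : Profile K :=
  WithLp.toLp 2 fun e => (if e.1.1 = k then 1 else 0) - (if e.1.2 = k then 1 else 0)

/-- The vector `c_(i,j,k)` of the cyclic relation `i ≽ j ≽ k ≽ i`. -/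
def triadVec (t : Triad K) : Profile K :=
  WithLp.toLp 2 fun e =>
    (if e.1 = (t.1.1, t.1.2.1) ∨ e.1 = (t.1.2.1, t.1.2.2) ∨ e.1 = (t.1.2.2, t.1.1)
      then 1 else 0) -
    (if e.1 = (t.1.2.1, t.1.1) ∨ e.1 = (t.1.2.2, t.1.2.1) ∨ e.1 = (t.1.1, t.1.2.2)
      then 1 else 0)

variable (K) in
/-- The space `𝓛` of linear profiles `ν_ij = μ_i - μ_j`. -/
def linearSpace : Submodule ℝ (Profile K) := Submodule.span ℝ (Set.range itemVec)

/-- The cyclic component of a profile: its orthogonal projection on the orthogonal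
complement of the space of linear profiles. -/
def cyclicPart (v : Profile K) : Profile K := (linearSpace K)ᗮ.starProjection v

variable (K) in
/-- The matrix of the linear map `cyclicPart` in the standard basis. -/
def cyclicMatrix : Matrix (Pair K) (Pair K) ℝ :=
  Matrix.of fun e f => cyclicPart (EuclideanSpace.single f (1 : ℝ)) e

/-- The linear span of the vectors `c_t`, `t ∈ T`. -/
def triadSpan (T : Finset (Triad K)) : Submodule ℝ (Profile K) :=
  Submodule.span ℝ (triadVec '' (T : Set (Triad K)))

/-- The model `span(B, C_s)`: linear profiles plus the span of the triads in `T`. -/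
def modelSpan (T : Finset (Triad K)) : Submodule ℝ (Profile K) :=
  linearSpace K ⊔ triadSpan T

/-! ### Minimal models -/

/-- `γ` represents the cyclic component of `ν`, i.e. `ν_cyclic = C γ`. -/
def Represents (γ : Triad K → ℝ) (ν : Profile K) : Prop :=
  ∑ t, γ t • triadVec t = cyclicPart ν

/-- The triads with a non-zero coefficient in `γ`. -/
def modelTriads (γ : Triad K → ℝ) : Finset (Triad K) := {t | γ t ≠ 0}

/-- `γ` is a minimal model: a representation of the cyclic component of `ν` with the least
possible number of non-zero coefficients. -/
def IsMinimalModel (γ : Triad K → ℝ) (ν : Profile K) : Prop :=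
  Represents γ ν ∧
    ∀ γ' : Triad K → ℝ, Represents γ' ν → (modelTriads γ).card ≤ (modelTriads γ').card

/-- The true model `𝓢`: the smallest subspace that contains all minimal models of `ν`
(each of them together with the linear profiles). -/
def trueModel (ν : Profile K) : Submodule ℝ (Profile K) :=
  linearSpace K ⊔ ⨆ γ : {γ : Triad K → ℝ // IsMinimalModel γ ν}, triadSpan (modelTriads γ.1)

/-- The number of ticks of the triad `t` in the tick-table of the profile `v`, i.e. the number
of pairs of `t` at which `v` is non-zero. -/
def tickCount (v : Profile K) (t : Triad K) : ℕ := (t.pairs.filter fun e => v e ≠ 0).card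

/-! ### Estimators -/

/-- The outcomes `Y_ijk = ν_ij + ε_ijk` at the sample point `ω` (`k = 0, 1, …`). -/
def outcomes {Ω : Type*} (ν : Profile K) (ε : Pair K → ℕ → Ω → ℝ) (ω : Ω) :
    Pair K → ℕ → ℝ := fun e k => ν e + ε e k ω

/-- The total number of comparisons. -/
def total (n : Pair K → ℕ) : ℕ := ∑ e, n e

/-- The least squares estimator of `ν` in the full model: the vector of averages of the first
`n e` outcomes of each pair `e`. -/
def pairMean (n : Pair K → ℕ) (Y : Pair K → ℕ → ℝ) : Profile K :=
  WithLp.toLp 2 fun e => (∑ k ∈ Finset.range (n e), Y e k) / n e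

/-- The variance estimator `σ̂²`. -/
def varEst (n : Pair K → ℕ) (Y : Pair K → ℕ → ℝ) : ℝ :=
  (∑ e, ∑ k ∈ Finset.range (n e), (Y e k - pairMean n Y e) ^ 2) / total n

/-- The sum of squares `Q` of the profile `u`. -/
def sumSquares (n : Pair K → ℕ) (Y : Pair K → ℕ → ℝ) (u : Profile K) : ℝ :=
  ∑ e, ∑ k ∈ Finset.range (n e), (Y e k - u e) ^ 2

/-- Multiplication by `D^{1/2}`, where `D` is the diagonal matrix of the `n e`. -/
def scale (n : Pair K → ℕ) : Profile K →ₗ[ℝ] Profile K where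
  toFun v := WithLp.toLp 2 fun e => √(n e : ℝ) * v e
  map_add' u v := by ext e; simp [mul_add]
  map_smul' c v := by ext e; simp; ring

/-- The weighted least squares fit of `v` in the subspace `S`, with weights `n e`: the element
of `S` closest to `v` in the norm `‖D^{1/2} u‖`. Applied to `pairMean n Y` it is the least squares
estimator `ν̂_S` under the model `S` (see `fit_mem` and `sumSquares_fit_le`). -/
def fit (n : Pair K → ℕ) (S : Submodule ℝ (Profile K)) (v : Profile K) : Profile K :=
  WithLp.toLp 2 fun e => (√(n e : ℝ))⁻¹ * (S.map (scale n)).starProjection (scale n v) e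

theorem scale_fit (n : Pair K → ℕ) (hn : ∀ e, 0 < n e) (S : Submodule ℝ (Profile K))
    (v : Profile K) :
    scale n (fit n S v) = (S.map (scale n)).starProjection (scale n v) := by
  ext e
  have h : √(n e : ℝ) ≠ 0 := (Real.sqrt_pos.2 (by exact_mod_cast hn e)).ne'
  simp [scale, fit, mul_inv_cancel_left₀ h]

theorem fit_mem (n : Pair K → ℕ) (hn : ∀ e, 0 < n e) (S : Submodule ℝ (Profile K))
    (v : Profile K) : fit n S v ∈ S := by
  have h1 : (S.map (scale n)).starProjection (scale n v) ∈ S.map (scale n) :=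
    Submodule.starProjection_apply_mem _ _
  rw [← scale_fit n hn] at h1
  obtain ⟨u, hu, hu2⟩ := h1
  have h2 : u = fit n S v := by
    ext e
    have h : √(n e : ℝ) ≠ 0 := (Real.sqrt_pos.2 (by exact_mod_cast hn e)).ne'
    have h3 := congrArg (fun w : Profile K => w e) hu2
    simpa [scale, h] using h3
  exact h2 ▸ hu

/-- The fitted value minimises the sum of squares over the model. -/
theorem sumSquares_fit_le (n : Pair K → ℕ) (hn : ∀ e, 0 < n e)
    (S : Submodule ℝ (Profile K)) (Y : Pair K → ℕ → ℝ) (u : Profile K) (hu : u ∈ S) :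
    sumSquares n Y (fit n S (pairMean n Y)) ≤ sumSquares n Y u := by
  have key : ∀ w : Profile K, sumSquares n Y w =
      sumSquares n Y (pairMean n Y) + ‖scale n (pairMean n Y) - scale n w‖ ^ 2 := by
    intro w
    rw [EuclideanSpace.norm_sq_eq]
    unfold sumSquares
    rw [← Finset.sum_add_distrib]
    refine Finset.sum_congr rfl fun e _ => ?_
    have hne : (n e : ℝ) ≠ 0 := by exact_mod_cast (hn e).ne'
    have hm : ∑ k ∈ Finset.range (n e), Y e k = n e * pairMean n Y e := by
      simp only [pairMean]; field_simp
    have hs : ‖(scale n (pairMean n Y) - scale n w) e‖ ^ 2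
        = n e * (pairMean n Y e - w e) ^ 2 := by
      simp only [scale, LinearMap.coe_mk, AddHom.coe_mk, PiLp.sub_apply, Real.norm_eq_abs, sq_abs]
      rw [← mul_sub, mul_pow, Real.sq_sqrt (Nat.cast_nonneg _)]
    rw [hs]
    have h4 : ∀ x : ℝ, ∑ k ∈ Finset.range (n e), (Y e k - x) ^ 2 =
        ∑ k ∈ Finset.range (n e), (Y e k) ^ 2 - 2 * x * (n e * pairMean n Y e) + n e * x ^ 2 := by
      intro x
      rw [← hm, Finset.mul_sum, ← Finset.sum_sub_distrib]
      have : (n e : ℝ) * x ^ 2 = ∑ k ∈ Finset.range (n e), x ^ 2 := by simp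
      rw [this, ← Finset.sum_add_distrib]
      exact Finset.sum_congr rfl fun k _ => by ring
    rw [h4, h4]; ring
  rw [key, key u, scale_fit n hn]
  have hle := Submodule.starProjection_minimal (U := S.map (scale n)) (scale n (pairMean n Y))
  have h5 : ‖scale n (pairMean n Y) - (S.map (scale n)).starProjection (scale n (pairMean n Y))‖
      ≤ ‖scale n (pairMean n Y) - scale n u‖ := by
    rw [hle]
    exact ciInf_le (f := fun x : S.map (scale n) => ‖scale n (pairMean n Y) - x‖)
      ⟨0, by rintro _ ⟨x, rfl⟩; positivity⟩ ⟨scale n u, Submodule.mem_map_of_mem hu⟩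
  gcongr

/-! ### The tests of the hypotheses `ν_cyclic,ij = 0` -/

/-- The estimated standard error of the `e` coordinate of the cyclic part of `pairMean`: the
square root of the `(e, e)` entry of `σ̂² 𝐂 D⁻¹ 𝐂ᵀ`, with `𝐂` the projection matrix on the cyclic
profiles and `D` the diagonal matrix of the `n e`. -/
def stdErr (n : Pair K → ℕ) (Y : Pair K → ℕ → ℝ) (e : Pair K) : ℝ :=
  √(varEst n Y *
    (cyclicMatrix K * Matrix.diagonal (fun f => (n f : ℝ)⁻¹) * (cyclicMatrix K)ᵀ) e e)

/-- The two-sided p-value for `ν_cyclic,e = 0`, i.e. the probability that `|Z|` is at least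
`|ν̂_cyclic,e| / stdErr` for a standard normal `Z`. -/
def pairPValue (n : Pair K → ℕ) (Y : Pair K → ℕ → ℝ) (e : Pair K) : ℝ :=
  (gaussianReal 0 1).real {z | |cyclicPart (pairMean n Y) e| ≤ |z| * stdErr n Y e}

/-- The ways to adjust for multiplicity: Bonferroni control of the family-wise error rate, and
control of the false discovery rate by ranked thresholds, either applied to each p-value
separately (`fdr`) or in the step-up manner of Benjamini and Hochberg (`fdrStepUp`). -/
inductive MultipleTesting : Type
  | bonferroni
  | fdr
  | fdrStepUp

/-- The rank of the p-value of `e` among all p-values. -/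
def pRank (p : Pair K → ℝ) (e : Pair K) : ℕ := (Finset.univ.filter fun f => p f ≤ p e).card

/-- The pair `e` is rejected at level `α` by the given procedure applied to the p-values `p`. -/
def MultipleTesting.Rejects (rule : MultipleTesting) (α : ℝ) (p : Pair K → ℝ) (e : Pair K) :
    Prop :=
  match rule with
  | bonferroni => p e < α / (K.choose 2 : ℝ)
  | fdr => p e < α * pRank p e / (K.choose 2 : ℝ)
  | fdrStepUp => ∃ f, p e ≤ p f ∧ p f < α * pRank p f / (K.choose 2 : ℝ)

open Classical in
/-- The vector `ν*_cyclic`: the estimated cyclic part, set to zero at the pairs that are not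
rejected. -/
def cyclicStar (rule : MultipleTesting) (α : ℝ) (n : Pair K → ℕ) (Y : Pair K → ℕ → ℝ) :
    Profile K :=
  WithLp.toLp 2 fun e =>
    if rule.Rejects α (pairPValue n Y) e then cyclicPart (pairMean n Y) e else 0

/-! ### The lack-of-fit test -/

/-- The statistic `R_{n,S} = ‖D^{1/2} (S̄ - ν̂_S)‖²`. -/
def lackOfFit (n : Pair K → ℕ) (S : Submodule ℝ (Profile K)) (Y : Pair K → ℕ → ℝ) : ℝ :=
  ∑ e, (√(n e : ℝ) * (pairMean n Y e - fit n S (pairMean n Y) e)) ^ 2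

/-- The matrix `M = I - X (Xᵀ Ξ X)⁺ Xᵀ Ξ`, for `Ξ` the diagonal matrix of the proportions
`n e / total n` and `X` a matrix whose columns span `S`: it sends a profile to the residual of its
weighted least squares fit in `S`. -/
def residualMatrix (n : Pair K → ℕ) (S : Submodule ℝ (Profile K)) :
    Matrix (Pair K) (Pair K) ℝ :=
  1 - Matrix.of fun e f => fit n S (EuclideanSpace.single f (1 : ℝ)) e

/-- The proportion `n e / total n`. -/
def proportion (n : Pair K → ℕ) (e : Pair K) : ℝ := (n e : ℝ) / total n

/-- The matrix `Ψ_S = s · Ξ^{1/2} M Ξ⁺ Mᵀ Ξ^{1/2}`. -/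
def psiMatrix (n : Pair K → ℕ) (S : Submodule ℝ (Profile K)) (s : ℝ) :
    Matrix (Pair K) (Pair K) ℝ :=
  s • (Matrix.diagonal (fun e => √(proportion n e)) * residualMatrix n S *
    Matrix.diagonal (fun e => (proportion n e)⁻¹) * (residualMatrix n S)ᵀ *
    Matrix.diagonal (fun e => √(proportion n e)))

theorem psiMatrix_isHermitian (n : Pair K → ℕ) (S : Submodule ℝ (Profile K)) (s : ℝ) :
    (psiMatrix n S s).IsHermitian := by
  unfold psiMatrix Matrix.IsHermitian
  rw [Matrix.conjTranspose_eq_transpose_of_trivial]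
  simp [Matrix.transpose_mul, Matrix.mul_assoc]

/-- The p-value of the lack-of-fit test of `ν ∈ S`: the probability that `∑ λ_e Z_e²` is at least
`R_{n,S}`, where the `Z_e` are independent standard normal and the `λ_e` are the eigenvalues of
`Ψ_S`, with `σ²` estimated by `varEst`. -/
def lackOfFitPValue (n : Pair K → ℕ) (S : Submodule ℝ (Profile K)) (Y : Pair K → ℕ → ℝ) : ℝ :=
  (Measure.pi fun _ : Pair K => gaussianReal 0 1).real
    {z | lackOfFit n S Y ≤
      ∑ e, (psiMatrix_isHermitian n S (varEst n Y)).eigenvalues e * z e ^ 2}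

/-- The lack-of-fit test rejects `ν ∈ S` at level `α`; this is `R_{n,S} ≥ c_α` for the upper
`α` quantile `c_α` of `∑ λ_e Z_e²`. -/
def LackOfFitRejects (α : ℝ) (n : Pair K → ℕ) (S : Submodule ℝ (Profile K))
    (Y : Pair K → ℕ → ℝ) : Prop :=
  lackOfFitPValue n S Y ≤ α

/-! ### The algorithm -/

/-- `lin` selects from every set of triads a maximal set of triads whose vectors are linearly
independent. -/
def IsBasisChoice (lin : Finset (Triad K) → Finset (Triad K)) : Prop :=
  ∀ A, lin A ⊆ A ∧ LinearIndepOn ℝ triadVec (lin A : Set (Triad K)) ∧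
    ∀ t ∈ A, triadVec t ∈ triadSpan (lin A)

/-- The triads with exactly `a` ticks in the tick-table of `v`. -/
def ticked (v : Profile K) (a : ℕ) : Finset (Triad K) := {t | tickCount v t = a}

/-! The first candidate model is `𝓛` itself, with no triads. -/

/-- Triads of the second candidate model: the set `𝓒_{3,lin}`. -/
def candidate₂ (lin : Finset (Triad K) → Finset (Triad K)) (v : Profile K) :
    Finset (Triad K) := lin (ticked v 3)

open Classical in
/-- Triads of the third candidate model: `𝓒_{3,lin} ∪ 𝓒⁺_{2,lin}`. -/
def candidate₃ (lin : Finset (Triad K) → Finset (Triad K)) (v : Profile K) :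
    Finset (Triad K) :=
  candidate₂ lin v ∪
    (lin (ticked v 2)).filter fun t => triadVec t ∉ triadSpan (candidate₂ lin v)

open Classical in
/-- Triads of the fourth candidate model: `𝓒_{3,lin} ∪ 𝓒⁺_{2,lin} ∪ 𝓒⁺_{1,lin}`. -/
def candidate₄ (lin : Finset (Triad K) → Finset (Triad K)) (v : Profile K) :
    Finset (Triad K) :=
  candidate₃ lin v ∪
    (lin (ticked v 1)).filter fun t => triadVec t ∉ triadSpan (candidate₃ lin v)

open Classical in
/-- Forward tick-based selection: the set of triads of the selected model. The candidate models
built from the estimated tick-table are tested for lack of fit in turn, the first one that is not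
rejected is selected, and the last one is selected if the first three are rejected. -/
def ftbs (rule : MultipleTesting) (lin : Finset (Triad K) → Finset (Triad K)) (α : ℝ)
    (n : Pair K → ℕ) (Y : Pair K → ℕ → ℝ) : Finset (Triad K) :=
  if ¬ LackOfFitRejects α n (modelSpan ∅) Y then ∅
  else if ¬ LackOfFitRejects α n (modelSpan (candidate₂ lin (cyclicStar rule α n Y))) Y then
    candidate₂ lin (cyclicStar rule α n Y)
  else if ¬ LackOfFitRejects α n (modelSpan (candidate₃ lin (cyclicStar rule α n Y))) Y then
    candidate₃ lin (cyclicStar rule α n Y)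
  else candidate₄ lin (cyclicStar rule α n Y)

end PairedComparison

end

open PairedComparison

/-!
The argument separates a deterministic from a probabilistic part.

*Combinatorics.* The triads `(z, j, k)` through the first item `z` form a basis of the cyclic
profiles, in which the coefficient of `(z, j, k)` is the coordinate `(j, k)`. Hence a cyclic profile
is a combination of triads that meet its support (`mem_span_triads_of_mem_orthogonal`), and the
last candidate model contains the cyclic part of `ν` as soon as every pair of its support is
rejected (`cyclicPart_mem_candidate₄`). Together with the rejection of every false model this gives
a correct selection (`cyclicPart_mem_ftbs`). If the triads of a minimal model have no common pairs,
the support of the cyclic part is the disjoint union of their pairs; under the closure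
assumption the triads with three ticks are then exactly those of the model, and a count of pairs
shows that every minimal model has its triads among them (`modelTriads_subset`). So if all tests
are correct, the second candidate is selected, or the first if the cyclic part is zero
(`ftbs_eq_modelTriads`).

*Tests of false hypotheses at a fixed level.* If the averages are close to `ν`, then the
standardized coordinates and the lack-of-fit statistics are large unless the estimated variance is
of the order of the numbers of comparisons (`eventually_rejects`, `eventually_lackOfFitRejects`).
The matrix `Ψ_S` is a multiple of an orthogonal projection, so that its eigenvalues are `0` and
the estimated variance (`eigenvalues_psiMatrix`). By the strong law of large numbers the
favourable event occurs eventually, almost surely, which gives consistency. For sub-Gaussian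
errors a union bound over all errors bounds the variance estimator and the Chernoff bound controls
the averages, which gives the exponential rate (`IsErrorModel.exponential_bound`).

*Tests of true hypotheses at levels tending to zero.* No limit theorem is needed. By the
Cauchy–Schwarz inequality the squared coordinate of the estimated cyclic part, and by contraction
the lack-of-fit statistic, are controlled by `∑ n_e (S̄_e - ν_e)²`, whose expectation is bounded. So
the p-values of true hypotheses are bounded away from zero in probability
(`chiSqTail_le_pairPValue`, `chiSqTail_le_lackOfFitPValue`), and exceed a level that tends to zero.
The assumed power of the other tests is combined with this by a union bound over complements,
which requires that the rejection events be measurable.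
-/

namespace PairedComparison

variable {K : ℕ}

/-! ### Triads and cyclic profiles -/

theorem Triad.mem_pairs {t : Triad K} {e : Pair K} :
    e ∈ t.pairs ↔ e.1 = (t.1.1, t.1.2.1) ∨ e.1 = (t.1.1, t.1.2.2) ∨ e.1 = (t.1.2.1, t.1.2.2) := by
  simp [Triad.pairs, Subtype.ext_iff]

theorem Triad.card_pairs (t : Triad K) : t.pairs.card = 3 := by
  obtain ⟨⟨i, j, k⟩, h1, h2⟩ := t
  simp only at h1 h2
  rw [Triad.pairs, Finset.card_eq_three]
  exact ⟨_, _, _, by simp [h2.ne], by simp [h1.ne], by simp [h1.ne], rfl⟩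

theorem Triad.fst_mem_items {t : Triad K} {e : Pair K} (h : e ∈ t.pairs) : e.1.1 ∈ t.items := by
  rcases Triad.mem_pairs.1 h with h | h | h <;> simp [h, Triad.items]

theorem Triad.snd_mem_items {t : Triad K} {e : Pair K} (h : e ∈ t.pairs) : e.1.2 ∈ t.items := by
  rcases Triad.mem_pairs.1 h with h | h | h <;> simp [h, Triad.items]

/-- Triads with at most one common item have no common pair. -/
theorem Triad.eq_of_mem_pairs {T : Finset (Triad K)}
    (hT : ∀ t ∈ T, ∀ u ∈ T, t ≠ u → (t.items ∩ u.items).card ≤ 1)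
    {t u : Triad K} (ht : t ∈ T) (hu : u ∈ T) {e : Pair K} (h1 : e ∈ t.pairs) (h2 : e ∈ u.pairs) :
    t = u := by
  by_contra hne
  have h3 : 1 < (t.items ∩ u.items).card :=
    Finset.one_lt_card.2 ⟨e.1.1,
      Finset.mem_inter.2 ⟨Triad.fst_mem_items h1, Triad.fst_mem_items h2⟩,
      e.1.2, Finset.mem_inter.2 ⟨Triad.snd_mem_items h1, Triad.snd_mem_items h2⟩, e.2.ne⟩
  exact absurd (hT t ht u hu hne) (by omega)

/-- Since pairs are ordered, only three of the six conditions in `triadVec` can hold. -/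
theorem triadVec_apply (t : Triad K) (e : Pair K) :
    triadVec t e = (if e.1 = (t.1.1, t.1.2.1) then 1 else 0)
      + (if e.1 = (t.1.2.1, t.1.2.2) then 1 else 0)
      - (if e.1 = (t.1.1, t.1.2.2) then 1 else 0) := by
  obtain ⟨⟨i, j, k⟩, h1, h2⟩ := t
  obtain ⟨⟨a, b⟩, hab⟩ := e
  simp only at h1 h2 hab
  have a1 : ¬ (a = k ∧ b = i) := by rintro ⟨rfl, rfl⟩; exact lt_asymm hab (h1.trans h2)
  have a2 : ¬ (a = j ∧ b = i) := by rintro ⟨rfl, rfl⟩; exact lt_asymm hab h1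
  have a3 : ¬ (a = k ∧ b = j) := by rintro ⟨rfl, rfl⟩; exact lt_asymm hab h2
  have a4 : ¬ ((a = i ∧ b = j) ∧ (a = j ∧ b = k)) := by
    rintro ⟨⟨rfl, rfl⟩, h, -⟩; exact h1.ne h
  simp only [triadVec, Prod.mk.injEq, a1, a2, a3, false_or, or_false]
  congr 1
  by_cases b1 : a = i ∧ b = j
  · rw [if_pos (Or.inl b1), if_pos b1, if_neg fun b2 => a4 ⟨b1, b2⟩, add_zero]
  · simp only [b1, false_or, if_false, zero_add]

theorem triadVec_eq_zero {t : Triad K} {e : Pair K} (h : e ∉ t.pairs) : triadVec t e = 0 := by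
  rw [Triad.mem_pairs] at h
  push Not at h
  simp [triadVec_apply, h.1, h.2.1, h.2.2]

theorem triadVec_ne_zero {t : Triad K} {e : Pair K} (h : e ∈ t.pairs) : triadVec t e ≠ 0 := by
  obtain ⟨⟨i, j, k⟩, h1, h2⟩ := t
  have h1' := h1.ne
  have h2' := h2.ne
  rcases Triad.mem_pairs.1 h with h | h | h <;>
    simp_all [triadVec_apply, Prod.ext_iff, h1'.symm, h2'.symm]

theorem inner_eq_sum (u v : Profile K) : inner ℝ u v = ∑ e, u e * v e := by
  simp [PiLp.inner_apply, mul_comm]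

theorem inner_triadVec_itemVec (t : Triad K) (k : Fin K) :
    inner ℝ (triadVec t) (itemVec k) = 0 := by
  have key : ∀ (p : Fin K × Fin K) (hp : p.1 < p.2) (g : Pair K → ℝ),
      ∑ e : Pair K, (if e.1 = p then (1 : ℝ) else 0) * g e = g ⟨p, hp⟩ := by
    intro p hp g
    rw [Finset.sum_eq_single ⟨p, hp⟩]
    · simp
    · intro b _ hb
      rw [if_neg (fun h => hb (Subtype.ext h)), zero_mul]
    · simp
  rw [inner_eq_sum]
  simp only [triadVec_apply, sub_mul, add_mul, Finset.sum_sub_distrib, Finset.sum_add_distrib]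
  rw [key _ t.2.1, key _ t.2.2, key _ (t.2.1.trans t.2.2)]
  simp only [itemVec]
  ring

theorem triadVec_mem_orthogonal (t : Triad K) : triadVec t ∈ (linearSpace K)ᗮ := by
  rw [Submodule.mem_orthogonal']
  intro u hu
  refine Submodule.span_induction (p := fun u _ => inner ℝ (triadVec t) u = 0) ?_ ?_ ?_ ?_ hu
  · rintro _ ⟨k, rfl⟩; exact inner_triadVec_itemVec t k
  · simp
  · intro x y _ _ hx hy; rw [inner_add_right, hx, hy, add_zero]
  · intro a x _ hx; rw [inner_smul_right, hx, mul_zero]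

/-- A cyclic profile that vanishes at all pairs without the first item is zero. -/
theorem eq_zero_of_mem_orthogonal {w : Profile K} (hw : w ∈ (linearSpace K)ᗮ) (z : Fin K)
    (h0 : ∀ e : Pair K, e.1.1 ≠ z → w e = 0) : w = 0 := by
  ext e
  by_cases he : e.1.1 = z
  · have h1 : inner ℝ w (itemVec e.1.2) = 0 :=
      Submodule.mem_orthogonal' _ _ |>.1 hw _ (Submodule.subset_span ⟨_, rfl⟩)
    rw [inner_eq_sum, Finset.sum_eq_single e] at h1
    · simpa [itemVec, e.2.ne] using h1
    · intro f _ hf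
      by_cases hfz : f.1.1 = z
      · have h2 : f.1.1 ≠ e.1.2 := by rw [hfz, ← he]; exact e.2.ne
        have h3 : f.1.2 ≠ e.1.2 := fun h => hf (Subtype.ext (Prod.ext (hfz.trans he.symm) h))
        simp [itemVec, h2, h3]
      · simp [h0 f hfz]
    · simp
  · simpa using h0 e he

/-- The triads through the first item are a basis of the cyclic profiles, and the coefficient of
`(z, j, k)` in this basis is the coordinate `(j, k)`: so a cyclic profile is a combination of
triads that have at least one pair in its support. -/
theorem mem_span_triads_of_mem_orthogonal {v : Profile K} (hv : v ∈ (linearSpace K)ᗮ)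
    (V : Submodule ℝ (Profile K))
    (hV : ∀ t : Triad K, (∃ e ∈ t.pairs, v e ≠ 0) → triadVec t ∈ V) : v ∈ V := by
  classical
  by_cases hK : Nonempty (Pair K)
  swap
  · have : v = 0 := by ext e; exact absurd ⟨e⟩ hK
    rw [this]; exact V.zero_mem
  obtain ⟨e₀⟩ := hK
  have hKpos : 0 < K := e₀.1.1.pos
  let z : Fin K := ⟨0, hKpos⟩
  have hz : ∀ k, z ≤ k := fun k => Nat.zero_le _
  let u : Profile K := ∑ t : Triad K, if t.1.1 = z then
    v ⟨(t.1.2.1, t.1.2.2), t.2.2⟩ • triadVec t else 0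
  have huV : u ∈ V := by
    refine Submodule.sum_mem _ fun t _ => ?_
    split_ifs with h
    · by_cases h0 : v ⟨(t.1.2.1, t.1.2.2), t.2.2⟩ = 0
      · rw [h0, zero_smul]; exact V.zero_mem
      · exact V.smul_mem _ (hV t ⟨_, Triad.mem_pairs.2 (Or.inr (Or.inr rfl)), h0⟩)
    · exact V.zero_mem
  have huL : u ∈ (linearSpace K)ᗮ := by
    refine Submodule.sum_mem _ fun t _ => ?_
    split_ifs with h
    · exact Submodule.smul_mem _ _ (triadVec_mem_orthogonal t)
    · exact Submodule.zero_mem _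
  have hvu : v - u = 0 := by
    refine eq_zero_of_mem_orthogonal (Submodule.sub_mem _ hv huL) z fun e he => ?_
    have hza : ∀ a, e.1 ≠ (z, a) := fun a h => he (congrArg Prod.fst h)
    have hze : z < e.1.1 := lt_of_le_of_ne (hz _) (Ne.symm he)
    have hu : u e = v e := by
      have h1 : u e = ∑ t : Triad K, (if t.1.1 = z then
          v ⟨(t.1.2.1, t.1.2.2), t.2.2⟩ • triadVec t else 0) e := by
        simp only [u, WithLp.ofLp_sum, Finset.sum_apply]
      rw [h1, Finset.sum_eq_single ⟨(z, e.1.1, e.1.2), hze, e.2⟩]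
      · simp [triadVec_apply, hza]
      · intro t _ ht
        split_ifs with h
        · have h2 : e.1 ≠ (t.1.2.1, t.1.2.2) := by
            intro h3
            apply ht
            refine Subtype.ext (Prod.ext h ?_)
            exact h3.symm
          have h3 : ∀ a, e.1 ≠ (t.1.1, a) := by
            intro a h3
            exact he ((congrArg Prod.fst h3).trans h)
          simp [triadVec_apply, h2, h3]
        · simp
      · simp
    simp [hu]
  rw [sub_eq_zero.1 hvu]
  exact huV

theorem cyclicPart_mem_orthogonal (v : Profile K) : cyclicPart v ∈ (linearSpace K)ᗮ :=
  Submodule.starProjection_apply_mem _ _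

theorem sub_cyclicPart_mem (v : Profile K) : v - cyclicPart v ∈ linearSpace K := by
  have := Submodule.sub_starProjection_mem_orthogonal (K := (linearSpace K)ᗮ) v
  rwa [Submodule.orthogonal_orthogonal] at this

theorem cyclicPart_mem_modelSpan_iff {v : Profile K} {T : Finset (Triad K)} :
    cyclicPart v ∈ modelSpan T ↔ v ∈ modelSpan T := by
  have h : v - cyclicPart v ∈ modelSpan T := Submodule.mem_sup_left (sub_cyclicPart_mem v)
  constructor
  · intro h1; simpa using Submodule.add_mem _ h h1
  · intro h1; simpa using Submodule.sub_mem _ h1 h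

theorem triadSpan_mono {S T : Finset (Triad K)} (h : S ⊆ T) : triadSpan S ≤ triadSpan T :=
  Submodule.span_mono (Set.image_mono (by exact_mod_cast h))

theorem triadVec_mem_triadSpan {T : Finset (Triad K)} {t : Triad K} (h : t ∈ T) :
    triadVec t ∈ triadSpan T :=
  Submodule.subset_span ⟨t, by exact_mod_cast h, rfl⟩

theorem tickCount_le (v : Profile K) (t : Triad K) : tickCount v t ≤ 3 :=
  (Finset.card_filter_le _ _).trans t.card_pairs.le

open Classical in
/-- Adding to `A` those vectors of a spanning subset of `B` that are outside the span of `A`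
gives a set that spans all of `B`. -/
theorem triadVec_mem_triadSpan_union {lin : Finset (Triad K) → Finset (Triad K)}
    (hlin : IsBasisChoice lin) (A B : Finset (Triad K)) {t : Triad K} (ht : t ∈ B) :
    triadVec t ∈ triadSpan (A ∪ (lin B).filter fun t => triadVec t ∉ triadSpan A) := by
  have h1 : triadSpan (lin B) ≤
      triadSpan (A ∪ (lin B).filter fun t => triadVec t ∉ triadSpan A) := by
    refine Submodule.span_le.2 ?_
    rintro _ ⟨u, hu, rfl⟩
    by_cases h : triadVec u ∈ triadSpan A
    · exact triadSpan_mono Finset.subset_union_left h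
    · exact triadVec_mem_triadSpan
        (Finset.mem_union_right _ (Finset.mem_filter.2 ⟨by exact_mod_cast hu, h⟩))
  exact h1 ((hlin B).2.2 t ht)

/-- The last candidate model spans all triads with at least one tick. -/
theorem triadVec_mem_candidate₄ {lin : Finset (Triad K) → Finset (Triad K)}
    (hlin : IsBasisChoice lin) (v : Profile K) {t : Triad K} (ht : tickCount v t ≠ 0) :
    triadVec t ∈ triadSpan (candidate₄ lin v) := by
  classical
  have h := tickCount_le v t
  have hm : ∀ a, tickCount v t = a → t ∈ ticked v a := fun a ha => by simp [ticked, ha]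
  have h34 : triadSpan (candidate₃ lin v) ≤ triadSpan (candidate₄ lin v) :=
    triadSpan_mono Finset.subset_union_left
  have h23 : triadSpan (candidate₂ lin v) ≤ triadSpan (candidate₃ lin v) :=
    triadSpan_mono Finset.subset_union_left
  obtain h1 | h2 | h3 : tickCount v t = 1 ∨ tickCount v t = 2 ∨ tickCount v t = 3 := by omega
  · exact triadVec_mem_triadSpan_union hlin _ _ (hm 1 h1)
  · exact h34 (triadVec_mem_triadSpan_union hlin _ _ (hm 2 h2))
  · exact h34 (h23 ((hlin _).2.2 t (hm 3 h3)))

/-- If the support of `v` contains that of the cyclic part of `ν`, then the last candidate model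
built from `v` contains the cyclic part of `ν`. -/
theorem cyclicPart_mem_candidate₄ {lin : Finset (Triad K) → Finset (Triad K)}
    (hlin : IsBasisChoice lin) (ν v : Profile K) (h : ∀ e, cyclicPart ν e ≠ 0 → v e ≠ 0) :
    cyclicPart ν ∈ modelSpan (candidate₄ lin v) := by
  refine Submodule.mem_sup_right
    (mem_span_triads_of_mem_orthogonal (cyclicPart_mem_orthogonal ν) _ ?_)
  rintro t ⟨e, he, hne⟩
  refine triadVec_mem_candidate₄ hlin v ?_
  rw [tickCount, Finset.card_ne_zero]
  exact ⟨e, Finset.mem_filter.2 ⟨he, h e hne⟩⟩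

/-! ### Minimal models with triads that share at most one item -/

theorem Represents.apply_eq {γ : Triad K → ℝ} {ν : Profile K} (h : Represents γ ν) (e : Pair K) :
    cyclicPart ν e = ∑ t, γ t * triadVec t e := by
  rw [← show _ = _ from h]
  simp only [WithLp.ofLp_sum, Finset.sum_apply, PiLp.smul_apply, smul_eq_mul]

theorem mem_modelTriads {γ : Triad K → ℝ} {t : Triad K} : t ∈ modelTriads γ ↔ γ t ≠ 0 := by
  simp [modelTriads]

theorem Represents.exists_mem_pairs {γ : Triad K → ℝ} {ν : Profile K} (h : Represents γ ν)
    {e : Pair K} (he : cyclicPart ν e ≠ 0) : ∃ t ∈ modelTriads γ, e ∈ t.pairs := by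
  rw [h.apply_eq] at he
  obtain ⟨t, -, ht⟩ := Finset.exists_ne_zero_of_sum_ne_zero he
  refine ⟨t, mem_modelTriads.2 (left_ne_zero_of_mul ht), ?_⟩
  by_contra h1
  exact right_ne_zero_of_mul ht (triadVec_eq_zero h1)

theorem Represents.mem_modelSpan {γ : Triad K → ℝ} {ν : Profile K} (h : Represents γ ν) :
    ν ∈ modelSpan (modelTriads γ) := by
  rw [← cyclicPart_mem_modelSpan_iff, ← show _ = _ from h]
  refine Submodule.mem_sup_right (Submodule.sum_mem _ fun t _ => ?_)
  by_cases h0 : γ t = 0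
  · simp [h0]
  · exact Submodule.smul_mem _ _ (triadVec_mem_triadSpan (mem_modelTriads.2 h0))

/-- For triads without common pairs there is no cancellation: the support of the cyclic part is
the union of the pairs of the triads. -/
theorem cyclicPart_ne_zero_iff {γ : Triad K → ℝ} {ν : Profile K} (hγ : Represents γ ν)
    (hdis : ∀ t ∈ modelTriads γ, ∀ u ∈ modelTriads γ, t ≠ u → (t.items ∩ u.items).card ≤ 1)
    (e : Pair K) :
    cyclicPart ν e ≠ 0 ↔ ∃ t ∈ modelTriads γ, e ∈ t.pairs := by
  refine ⟨fun h => hγ.exists_mem_pairs h, ?_⟩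
  rintro ⟨t, ht, he⟩
  rw [hγ.apply_eq, Finset.sum_eq_single t]
  · exact mul_ne_zero (mem_modelTriads.1 ht) (triadVec_ne_zero he)
  · intro u _ hu
    by_cases h0 : γ u = 0
    · simp [h0]
    · rw [triadVec_eq_zero, mul_zero]
      exact fun h => hu (Triad.eq_of_mem_pairs hdis (mem_modelTriads.2 h0) ht h he)
  · simp

/-- By the closure assumption, the triads with three ticks are exactly those of the model. -/
theorem ticked_three_eq {γ : Triad K → ℝ} {ν : Profile K} (hγ : Represents γ ν)
    (hdis : ∀ t ∈ modelTriads γ, ∀ u ∈ modelTriads γ, t ≠ u → (t.items ∩ u.items).card ≤ 1)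
    (hcl : ∀ t : Triad K, (∀ e ∈ t.pairs, ∃ u ∈ modelTriads γ, e ∈ u.pairs) → t ∈ modelTriads γ)
    {v : Profile K} (hv : ∀ e, v e ≠ 0 ↔ cyclicPart ν e ≠ 0) :
    ticked v 3 = modelTriads γ := by
  ext t
  have h1 : t ∈ ticked v 3 ↔ ∀ e ∈ t.pairs, v e ≠ 0 := by
    rw [← Finset.filter_eq_self, ticked, Finset.mem_filter, tickCount]
    simp only [Finset.mem_univ, true_and]
    constructor
    · intro h
      exact Finset.eq_of_subset_of_card_le (Finset.filter_subset _ _) (by rw [h, t.card_pairs])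
    · intro h
      rw [h, t.card_pairs]
  rw [h1]
  constructor
  · intro h
    exact hcl t fun e he => (cyclicPart_ne_zero_iff hγ hdis e).1 ((hv e).1 (h e he))
  · intro ht e he
    exact (hv e).2 ((cyclicPart_ne_zero_iff hγ hdis e).2 ⟨t, ht, he⟩)

/-- A representation with at most as many triads has to use each of its pairs exactly once and
inside the support, so its triads are among those of `γ`. -/
theorem modelTriads_subset {γ : Triad K → ℝ} {ν : Profile K} (hγ : Represents γ ν)
    (hdis : ∀ t ∈ modelTriads γ, ∀ u ∈ modelTriads γ, t ≠ u → (t.items ∩ u.items).card ≤ 1)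
    (hcl : ∀ t : Triad K, (∀ e ∈ t.pairs, ∃ u ∈ modelTriads γ, e ∈ u.pairs) → t ∈ modelTriads γ)
    {γ' : Triad K → ℝ} (hγ' : Represents γ' ν)
    (hcard : (modelTriads γ').card ≤ (modelTriads γ).card) :
    modelTriads γ' ⊆ modelTriads γ := by
  classical
  let U := (modelTriads γ).biUnion Triad.pairs
  let U' := (modelTriads γ').biUnion Triad.pairs
  have hU : U.card = (modelTriads γ).card * 3 := by
    rw [Finset.card_biUnion, Finset.sum_const_nat fun t _ => t.card_pairs]
    intro t ht u hu htu
    refine Finset.disjoint_left.2 fun e h1 h2 => htu ?_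
    exact Triad.eq_of_mem_pairs hdis (by exact_mod_cast ht) (by exact_mod_cast hu) h1 h2
  have hU' : U'.card ≤ (modelTriads γ').card * 3 :=
    Finset.card_biUnion_le_card_mul _ _ _ fun t _ => t.card_pairs.le
  have hsub : U ⊆ U' := by
    intro e he
    obtain ⟨t, ht, h⟩ := Finset.mem_biUnion.1 he
    exact Finset.mem_biUnion.2
      (hγ'.exists_mem_pairs ((cyclicPart_ne_zero_iff hγ hdis e).2 ⟨t, ht, h⟩))
  have heq : U = U' := Finset.eq_of_subset_of_card_le hsub (by omega)
  intro t ht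
  refine hcl t fun e he => ?_
  have h : e ∈ U := heq ▸ Finset.mem_biUnion.2 ⟨t, ht, he⟩
  exact Finset.mem_biUnion.1 h

/-- All minimal models have their triads among those of `γ`, so the true model is that of `γ`. -/
theorem modelSpan_eq_trueModel {γ : Triad K → ℝ} {ν : Profile K} (hmin : IsMinimalModel γ ν)
    (hdis : ∀ t ∈ modelTriads γ, ∀ u ∈ modelTriads γ, t ≠ u → (t.items ∩ u.items).card ≤ 1)
    (hcl : ∀ t : Triad K, (∀ e ∈ t.pairs, ∃ u ∈ modelTriads γ, e ∈ u.pairs) → t ∈ modelTriads γ) :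
    modelSpan (modelTriads γ) = trueModel ν := by
  refine le_antisymm (sup_le_sup_left ?_ _) (sup_le_sup_left ?_ _)
  · exact le_iSup (fun γ : {γ : Triad K → ℝ // IsMinimalModel γ ν} => triadSpan (modelTriads γ.1))
      ⟨γ, hmin⟩
  · refine iSup_le fun γ' => triadSpan_mono ?_
    exact modelTriads_subset hmin.1 hdis hcl γ'.2.1 (γ'.2.2 γ hmin.1)

/-- Triads without common pairs are linearly independent, so all of them are selected. -/
theorem lin_modelTriads {γ : Triad K → ℝ}
    (hdis : ∀ t ∈ modelTriads γ, ∀ u ∈ modelTriads γ, t ≠ u → (t.items ∩ u.items).card ≤ 1)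
    {lin : Finset (Triad K) → Finset (Triad K)} (hlin : IsBasisChoice lin) :
    lin (modelTriads γ) = modelTriads γ := by
  refine Finset.Subset.antisymm (hlin _).1 fun t ht => ?_
  by_contra hnot
  obtain ⟨e, he⟩ : t.pairs.Nonempty := Finset.card_pos.1 (by rw [t.card_pairs]; norm_num)
  refine triadVec_ne_zero he ?_
  refine Submodule.span_induction (p := fun (u : Profile K) _ => u e = 0) ?_ ?_ ?_ ?_
    ((hlin _).2.2 t ht)
  · rintro _ ⟨u, hu, rfl⟩
    refine triadVec_eq_zero fun h => hnot ?_
    rw [Triad.eq_of_mem_pairs hdis ht ((hlin _).1 (by exact_mod_cast hu)) he h]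
    exact_mod_cast hu
  · simp
  · intro x y _ _ hx hy; simp [hx, hy]
  · intro a x _ hx; simp [hx]

/-! ### Multiple testing -/

theorem card_pair : Fintype.card (Pair K) = K.choose 2 := by
  rw [Fintype.card_subtype]
  have h : ({p : Fin K × Fin K | p.1 < p.2} : Finset _) =
      Finset.univ.biUnion fun j : Fin K => (Finset.Iio j).map ⟨fun i => (i, j), fun a b h => by
        simpa using h⟩ := by
    ext ⟨i, j⟩
    simp only [Finset.mem_filter, Finset.mem_univ, true_and, Finset.mem_biUnion, Finset.mem_map,
      Finset.mem_Iio]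
    refine ⟨fun h => ⟨j, i, h, rfl⟩, ?_⟩
    rintro ⟨k, l, h, h2⟩
    obtain ⟨rfl, rfl⟩ := Prod.mk.inj h2
    exact h
  rw [h, Finset.card_biUnion]
  · simp only [Finset.card_map, Fin.card_Iio]
    rw [Fin.sum_univ_eq_sum_range (fun i => i) K, Finset.sum_range_id, Nat.choose_two_right]
  · intro j _ k _ hjk
    refine Finset.disjoint_left.2 fun x hx hy => hjk ?_
    obtain ⟨a, -, rfl⟩ := Finset.mem_map.1 hx
    obtain ⟨b, -, hb⟩ := Finset.mem_map.1 hy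
    exact (congrArg Prod.snd hb).symm

theorem choose_two_pos (e : Pair K) : (0 : ℝ) < K.choose 2 := by
  rw [← card_pair]
  exact_mod_cast Fintype.card_pos_iff.2 ⟨e⟩

theorem pRank_le (p : Pair K → ℝ) (e : Pair K) : (pRank p e : ℝ) ≤ K.choose 2 := by
  rw [← card_pair]
  exact_mod_cast Finset.card_le_univ _

theorem one_le_pRank (p : Pair K → ℝ) (e : Pair K) : (1 : ℝ) ≤ pRank p e := by
  have : 0 < pRank p e := Finset.card_pos.2 ⟨e, by simp⟩
  exact_mod_cast this

/-- Under each of the rules, only p-values below `α` are rejected. -/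
theorem MultipleTesting.Rejects.lt {rule : MultipleTesting} {α : ℝ} (hα : 0 < α)
    {p : Pair K → ℝ} {e : Pair K} (h : rule.Rejects α p e) : p e < α := by
  have hc := choose_two_pos e
  have h1 : α / K.choose 2 ≤ α := by
    refine div_le_self hα.le ?_
    exact_mod_cast hc
  have h2 : ∀ f, α * pRank p f / K.choose 2 ≤ α := fun f => by
    rw [div_le_iff₀ hc]
    exact mul_le_mul_of_nonneg_left (pRank_le p f) hα.le
  cases rule with
  | bonferroni => exact lt_of_lt_of_le h h1
  | fdr => exact lt_of_lt_of_le h (h2 e)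
  | fdrStepUp =>
    obtain ⟨f, hf1, hf2⟩ := h
    exact hf1.trans_lt (lt_of_lt_of_le hf2 (h2 f))

/-- Each of the rules rejects at least as often as Bonferroni's. -/
theorem MultipleTesting.rejects_of_lt (rule : MultipleTesting) {α : ℝ} (hα : 0 < α)
    {p : Pair K → ℝ} {e : Pair K} (h : p e < α / K.choose 2) : rule.Rejects α p e := by
  have h1 : p e < α * pRank p e / K.choose 2 := by
    refine h.trans_le (div_le_div_of_nonneg_right ?_ (choose_two_pos e).le)
    exact le_mul_of_one_le_right hα.le (one_le_pRank p e)
  cases rule with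
  | bonferroni => exact h
  | fdr => exact h1
  | fdrStepUp => exact ⟨e, le_rfl, h1⟩

theorem pairPValue_eq_one {n : Pair K → ℕ} {Y : Pair K → ℕ → ℝ} {e : Pair K}
    (h : cyclicPart (pairMean n Y) e = 0) : pairPValue n Y e = 1 := by
  have : {z : ℝ | |cyclicPart (pairMean n Y) e| ≤ |z| * stdErr n Y e} = Set.univ := by
    refine Set.eq_univ_of_forall fun z => ?_
    rw [Set.mem_ofPred_eq, h, abs_zero]
    exact mul_nonneg (abs_nonneg z) (Real.sqrt_nonneg _)
  rw [pairPValue, this]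
  simp

/-- A rejected pair has a non-zero estimated cyclic part, since otherwise its p-value is one. -/
theorem cyclicStar_ne_zero_iff {rule : MultipleTesting} {α : ℝ} (h0 : 0 < α) (h1 : α < 1)
    {n : Pair K → ℕ} {Y : Pair K → ℕ → ℝ} {e : Pair K} :
    cyclicStar rule α n Y e ≠ 0 ↔ rule.Rejects α (pairPValue n Y) e := by
  simp only [cyclicStar, ne_eq, ite_eq_right_iff, Classical.not_imp, and_iff_left_iff_imp]
  intro h h2
  have := h.lt h0
  rw [pairPValue_eq_one h2] at this
  exact absurd this h1.not_gt

/-! ### Tails of fixed measures -/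

theorem exists_measureReal_tail_le {Z : Type*} [MeasurableSpace Z] (μ : Measure Z)
    [IsFiniteMeasure μ] {f : Z → ℝ} (hf : Measurable f) {β : ℝ} (hβ : 0 < β) :
    ∃ q : ℝ, 0 < q ∧ μ.real {z | q ≤ f z} ≤ β := by
  have h1 : Tendsto (fun q : ℝ => μ {z | q ≤ f z}) atTop (𝓝 (μ (⋂ q : ℝ, {z | q ≤ f z}))) := by
    refine tendsto_measure_iInter_atTop
      (fun q => (measurableSet_le measurable_const hf).nullMeasurableSet)
      (fun a b hab z hz => hab.trans hz) ⟨0, measure_ne_top _ _⟩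
  have h2 : (⋂ q : ℝ, {z | q ≤ f z}) = ∅ := by
    refine Set.eq_empty_of_forall_notMem fun z hz => ?_
    have := Set.mem_iInter.1 hz (f z + 1)
    simp only [Set.mem_ofPred_eq] at this
    linarith
  rw [h2, measure_empty] at h1
  have h3 := (ENNReal.tendsto_toReal (by simp)).comp h1
  simp only [ENNReal.toReal_zero] at h3
  obtain ⟨q, hq, hq0⟩ := ((h3.eventually (gt_mem_nhds hβ)).and (eventually_gt_atTop 0)).exists
  exact ⟨q, hq0, le_of_lt hq⟩

/-- The probability that the square of a standard normal variable is at least `q`. -/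
noncomputable def chiSqTail (q : ℝ) : ℝ := (gaussianReal 0 1).real {z | q ≤ z ^ 2}

theorem chiSqTail_pos (q : ℝ) : 0 < chiSqTail q := by
  refine ENNReal.toReal_pos (fun h => ?_) (measure_ne_top _ _)
  have h1 : volume (Set.Ici √q) = 0 := by
    refine gaussianReal_absolutelyContinuous' 0 one_ne_zero (measure_mono_null ?_ h)
    intro z hz
    exact (Real.sqrt_le_left ((Real.sqrt_nonneg q).trans hz)).1 hz
  simp at h1

/-! ### The tests of single pairs -/

theorem apply_eq_sum_single (L : Profile K →L[ℝ] Profile K) (x : Profile K) (e : Pair K) :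
    L x e = ∑ f, L (EuclideanSpace.single f (1 : ℝ)) e * x f := by
  have h : x = ∑ f, x f • EuclideanSpace.single f (1 : ℝ) := by
    ext e; simp [WithLp.ofLp_sum, Finset.sum_apply, Pi.single_apply]
  conv_lhs => rw [h]
  simp only [map_sum, map_smul, WithLp.ofLp_sum, Finset.sum_apply, PiLp.smul_apply, smul_eq_mul]
  exact Finset.sum_congr rfl fun f _ => mul_comm _ _

theorem cyclicPart_apply (x : Profile K) (e : Pair K) :
    cyclicPart x e = ∑ f, cyclicMatrix K e f * x f :=
  apply_eq_sum_single _ x e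

theorem cyclicPart_sub (x y : Profile K) : cyclicPart (x - y) = cyclicPart x - cyclicPart y :=
  map_sub _ x y

theorem norm_cyclicPart_le (x : Profile K) : ‖cyclicPart x‖ ≤ ‖x‖ :=
  Submodule.norm_starProjection_apply_le _ x

/-- The factor `v` in the variance `σ² v` of the `e` coordinate of the estimated cyclic part. -/
noncomputable def varFactor (n : Pair K → ℕ) (e : Pair K) : ℝ := ∑ f, cyclicMatrix K e f ^ 2 / n f

theorem varFactor_nonneg (n : Pair K → ℕ) (e : Pair K) : 0 ≤ varFactor n e :=
  Finset.sum_nonneg fun _ _ => by positivity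

theorem stdErr_eq (n : Pair K → ℕ) (Y : Pair K → ℕ → ℝ) (e : Pair K) :
    stdErr n Y e = √(varEst n Y * varFactor n e) := by
  rw [stdErr, Matrix.mul_apply, varFactor]
  congr 2
  refine Finset.sum_congr rfl fun f _ => ?_
  rw [Matrix.mul_diagonal, Matrix.transpose_apply]
  ring

theorem varEst_nonneg (n : Pair K → ℕ) (Y : Pair K → ℕ → ℝ) : 0 ≤ varEst n Y := by
  unfold varEst; positivity

/-- The power of the test of a pair with non-zero cyclic part: as soon as the averages are close
to `ν` and the estimated variance is small in comparison with the numbers of comparisons, the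
pair is rejected. -/
theorem eventually_rejects (rule : MultipleTesting) {α : ℝ} (hα : 0 < α) (ν : Profile K)
    {e : Pair K} (he : cyclicPart ν e ≠ 0) :
    ∀ᶠ δ : ℝ in 𝓝[>] 0, ∀ (n : Pair K → ℕ) (Y : Pair K → ℕ → ℝ) (N : ℝ), 0 < N →
      (∀ e, N ≤ n e) → ‖pairMean n Y - ν‖ ≤ δ → varEst n Y ≤ δ * N →
      rule.Rejects α (pairPValue n Y) e := by
  obtain ⟨q, hq, hq2⟩ := exists_measureReal_tail_le (gaussianReal 0 1)
    (measurable_id.pow_const 2) (β := α / K.choose 2 / 2)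
    (half_pos (div_pos hα (choose_two_pos e)))
  set a := |cyclicPart ν e| with ha
  have hapos : 0 < a := abs_pos.2 he
  set B := ∑ f, cyclicMatrix K e f ^ 2 with hB
  have hB0 : 0 ≤ B := Finset.sum_nonneg fun _ _ => sq_nonneg _
  clear_value a B
  have hB1 : 0 < B + 1 := by linarith
  have hsmall : 0 < min (a / 2) (a ^ 2 / (4 * (B + 1) * q)) := by positivity
  filter_upwards [Ioc_mem_nhdsGT hsmall] with δ hδ n Y N hN hn hmean hvar
  obtain ⟨hδ0, hδ1⟩ := hδ
  refine rule.rejects_of_lt hα (lt_of_le_of_lt (le_trans ?_ hq2)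
    (half_lt_self (div_pos hα (choose_two_pos e))))
  refine measureReal_mono (fun z hz => ?_) (measure_ne_top _ _)
  simp only [Set.mem_ofPred_eq, id] at hz ⊢
  have h1 : a / 2 ≤ |cyclicPart (pairMean n Y) e| := by
    have h2 : |cyclicPart (pairMean n Y) e - cyclicPart ν e| ≤ δ := by
      have h3 := PiLp.norm_apply_le (cyclicPart (pairMean n Y - ν)) e
      rw [cyclicPart_sub] at h3
      refine h3.trans ?_
      rw [← cyclicPart_sub]
      exact (norm_cyclicPart_le _).trans hmean
    have h4 := abs_sub_abs_le_abs_sub (cyclicPart ν e) (cyclicPart (pairMean n Y) e)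
    rw [abs_sub_comm, ← ha] at h4
    have h5 := hδ1.trans (min_le_left _ _)
    linarith
  have h2 : varFactor n e ≤ B / N := by
    rw [hB, Finset.sum_div]
    exact Finset.sum_le_sum fun f _ => div_le_div_of_nonneg_left (sq_nonneg _) hN (hn f)
  have h3 : varEst n Y * varFactor n e ≤ δ * B := by
    calc varEst n Y * varFactor n e ≤ (δ * N) * (B / N) :=
          mul_le_mul hvar h2 (varFactor_nonneg n e) (by positivity)
      _ = δ * B := by field_simp
  have h4 : (a / 2) ^ 2 ≤ z ^ 2 * (δ * (B + 1)) := by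
    have h5 : (a / 2) ^ 2 ≤ (|z| * stdErr n Y e) ^ 2 :=
      pow_le_pow_left₀ (by positivity) (h1.trans hz) 2
    rw [mul_pow, sq_abs, stdErr_eq,
      Real.sq_sqrt (mul_nonneg (varEst_nonneg _ _) (varFactor_nonneg _ _))] at h5
    refine h5.trans (mul_le_mul_of_nonneg_left (h3.trans ?_) (sq_nonneg z))
    exact mul_le_mul_of_nonneg_left (le_add_of_nonneg_right zero_le_one) hδ0.le
  have h5 : δ * (4 * (B + 1) * q) ≤ a ^ 2 :=
    (le_div_iff₀ (by positivity)).1 (hδ1.trans (min_le_right _ _))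
  have h6 : q * (δ * (B + 1)) ≤ z ^ 2 * (δ * (B + 1)) := by
    calc q * (δ * (B + 1)) = δ * (4 * (B + 1) * q) / 4 := by ring
      _ ≤ a ^ 2 / 4 := by linarith
      _ = (a / 2) ^ 2 := by ring
      _ ≤ _ := h4
  exact le_of_mul_le_mul_right h6 (mul_pos hδ0 hB1)

/-- The sum of squares `∑ n_e (S̄_e - ν_e)²` of the standardized errors of the averages. -/
noncomputable def noiseEnergy (n : Pair K → ℕ) (ν : Profile K) (Y : Pair K → ℕ → ℝ) : ℝ :=
  ∑ e, (n e : ℝ) * (pairMean n Y e - ν e) ^ 2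

/-- By the Cauchy–Schwarz inequality the p-values of all true null hypotheses are bounded below
in terms of `noiseEnergy`. -/
theorem chiSqTail_le_pairPValue {M s : ℝ} (hs : 0 < s) {n : Pair K → ℕ} (hn : ∀ e, 0 < n e)
    {ν : Profile K} {Y : Pair K → ℕ → ℝ} (hM : noiseEnergy n ν Y ≤ M) (hvar : s ≤ varEst n Y)
    {e : Pair K} (he : cyclicPart ν e = 0) : chiSqTail (M / s) ≤ pairPValue n Y e := by
  refine measureReal_mono (fun z hz => ?_) (measure_ne_top _ _)
  simp only [Set.mem_ofPred_eq] at hz ⊢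
  have h1 : cyclicPart (pairMean n Y) e ^ 2 ≤ varFactor n e * M := by
    have h2 : cyclicPart (pairMean n Y) e
        = ∑ f, cyclicMatrix K e f / √(n f) * (√(n f) * (pairMean n Y f - ν f)) := by
      have h3 : cyclicPart (pairMean n Y) e = cyclicPart (pairMean n Y - ν) e := by
        rw [cyclicPart_sub, PiLp.sub_apply, he, sub_zero]
      rw [h3, cyclicPart_apply]
      refine Finset.sum_congr rfl fun f _ => ?_
      have : √(n f : ℝ) ≠ 0 := (Real.sqrt_pos.2 (by exact_mod_cast hn f)).ne'
      rw [PiLp.sub_apply]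
      field_simp
    rw [h2]
    refine (Finset.sum_mul_sq_le_sq_mul_sq _ _ _).trans ?_
    refine le_trans (le_of_eq ?_) (mul_le_mul_of_nonneg_left hM (varFactor_nonneg n e))
    simp only [div_pow, mul_pow, Real.sq_sqrt (Nat.cast_nonneg _)]
    rfl
  have h0 : 0 ≤ stdErr n Y e := Real.sqrt_nonneg _
  rw [← abs_of_nonneg h0, ← abs_mul]
  refine sq_le_sq.1 (h1.trans ?_)
  rw [mul_pow, stdErr_eq, Real.sq_sqrt (mul_nonneg (varEst_nonneg _ _) (varFactor_nonneg _ _))]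
  have h2 : M ≤ z ^ 2 * varEst n Y := by
    rw [div_le_iff₀ hs] at hz
    exact hz.trans (mul_le_mul_of_nonneg_left hvar (sq_nonneg z))
  calc varFactor n e * M ≤ varFactor n e * (z ^ 2 * varEst n Y) :=
        mul_le_mul_of_nonneg_left h2 (varFactor_nonneg n e)
    _ = _ := by ring

/-! ### The lack-of-fit test -/

/-- The residual projection `I - D^{1/2} X (Xᵀ D X)⁺ Xᵀ D^{1/2}`, with `X` a matrix whose columns
span `S`. -/
noncomputable def residualProj (n : Pair K → ℕ) (S : Submodule ℝ (Profile K)) :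
    Profile K →L[ℝ] Profile K := (S.map (scale n))ᗮ.starProjection

theorem residualProj_apply (n : Pair K → ℕ) (S : Submodule ℝ (Profile K)) (x : Profile K) :
    residualProj n S x = x - (S.map (scale n)).starProjection x := by
  simp [residualProj, Submodule.starProjection_orthogonal]

/-- `Ψ_S` is `s` times the matrix of an orthogonal projection. -/
theorem psiMatrix_mulVec {n : Pair K → ℕ} (hn : ∀ e, 0 < n e) (S : Submodule ℝ (Profile K))
    (s : ℝ) (x : Profile K) :
    psiMatrix n S s *ᵥ x.ofLp = (s • residualProj n S x).ofLp := by
  have hN : ∀ e : Pair K, (0 : ℝ) < total n := fun e => by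
    have : n e ≤ total n := Finset.single_le_sum (fun _ _ => Nat.zero_le _) (Finset.mem_univ e)
    exact_mod_cast (hn e).trans_le this
  have hn' : ∀ e, (0 : ℝ) < n e := fun e => by exact_mod_cast hn e
  have hentry : ∀ e f, √(proportion n e) * residualMatrix n S e f * (√(proportion n f))⁻¹ =
      residualProj n S (EuclideanSpace.single f (1 : ℝ)) e := by
    intro e f
    have h1 : scale n (EuclideanSpace.single f (1 : ℝ)) =
        √(n f : ℝ) • EuclideanSpace.single f (1 : ℝ) := by
      ext g
      by_cases hg : g = f
      · subst hg; simp [scale]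
      · simp [scale, hg]
    have h2 : √(proportion n e) * (√(n e : ℝ))⁻¹ * √(n f : ℝ) * (√(proportion n f))⁻¹ = 1 := by
      have a1 := (Real.sqrt_pos.2 (hn' e)).ne'
      have a2 := (Real.sqrt_pos.2 (hn' f)).ne'
      have a3 := (Real.sqrt_pos.2 (hN e)).ne'
      simp only [proportion, Real.sqrt_div (Nat.cast_nonneg _)]
      field_simp
    have h3 : √(proportion n e) * (1 : Matrix (Pair K) (Pair K) ℝ) e f * (√(proportion n f))⁻¹
        = (1 : Matrix (Pair K) (Pair K) ℝ) e f := by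
      by_cases h : e = f
      · subst h
        have : √(proportion n e) ≠ 0 := (Real.sqrt_pos.2 (div_pos (hn' e) (hN e))).ne'
        simp [this]
      · simp [h]
    rw [residualProj_apply, residualMatrix, Matrix.sub_apply, mul_sub, sub_mul, h3, PiLp.sub_apply,
      Matrix.of_apply, fit, h1, map_smul]
    simp only [PiLp.smul_apply, smul_eq_mul]
    have h4 : (1 : Matrix (Pair K) (Pair K) ℝ) e f = EuclideanSpace.single f (1 : ℝ) e := by
      simp [Matrix.one_apply]
    rw [h4]
    congr 1
    linear_combination
      ((S.map (scale n)).starProjection (EuclideanSpace.single f (1 : ℝ)) e) * h2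
  have hpsi : ∀ e e', psiMatrix n S s e e' =
      s * residualProj n S (EuclideanSpace.single e' (1 : ℝ)) e := by
    intro e e'
    have hsym : ∀ u v, inner ℝ (residualProj n S u) v = inner ℝ u (residualProj n S v) :=
      Submodule.inner_starProjection_left_eq_right _
    have hidem : ∀ u, residualProj n S (residualProj n S u) = residualProj n S u := fun u =>
      Submodule.starProjection_eq_self_iff.2 (Submodule.starProjection_apply_mem _ _)
    have hcoord : ∀ (u : Profile K) e, u e = inner ℝ (EuclideanSpace.single e (1 : ℝ)) u := by
      intro u e; simp [EuclideanSpace.inner_single_left]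
    have hQ : ∀ f g, residualProj n S (EuclideanSpace.single f (1 : ℝ)) g =
        residualProj n S (EuclideanSpace.single g (1 : ℝ)) f := by
      intro f g
      rw [hcoord, ← hsym, real_inner_comm, ← hcoord]
    have h1 : psiMatrix n S s e e' = s * ∑ f,
        residualProj n S (EuclideanSpace.single f (1 : ℝ)) e *
          residualProj n S (EuclideanSpace.single f (1 : ℝ)) e' := by
      rw [psiMatrix, Matrix.smul_apply, smul_eq_mul, Matrix.mul_diagonal, Matrix.mul_apply,
        Finset.sum_mul]
      congr 1
      refine Finset.sum_congr rfl fun f _ => ?_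
      rw [Matrix.mul_diagonal, Matrix.diagonal_mul, Matrix.transpose_apply, ← hentry, ← hentry]
      have : (proportion n f)⁻¹ = (√(proportion n f))⁻¹ * (√(proportion n f))⁻¹ := by
        rw [← mul_inv, Real.mul_self_sqrt
          (show 0 ≤ proportion n f from div_nonneg (hn' f).le (hN f).le)]
      rw [this]
      ring
    rw [h1]
    congr 1
    simp_rw [hQ _ e, hQ _ e']
    rw [← inner_eq_sum, hsym, hidem, ← hcoord]
  funext e
  rw [Matrix.mulVec, dotProduct, PiLp.smul_apply, smul_eq_mul, apply_eq_sum_single,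
    Finset.mul_sum]
  exact Finset.sum_congr rfl fun f _ => by rw [hpsi]; ring

theorem norm_residualProj_le (n : Pair K → ℕ) (S : Submodule ℝ (Profile K)) (x : Profile K) :
    ‖residualProj n S x‖ ≤ ‖x‖ := Submodule.norm_starProjection_apply_le _ x

theorem smul_residualProj_eigenvector {n : Pair K → ℕ} (hn : ∀ e, 0 < n e)
    (S : Submodule ℝ (Profile K)) (s : ℝ) (e : Pair K) :
    s • residualProj n S ((psiMatrix_isHermitian n S s).eigenvectorBasis e) =
      (psiMatrix_isHermitian n S s).eigenvalues e •
        (psiMatrix_isHermitian n S s).eigenvectorBasis e := by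
  have h := (psiMatrix_isHermitian n S s).mulVec_eigenvectorBasis e
  rw [psiMatrix_mulVec hn] at h
  ext f
  exact congrFun h f

/-- The eigenvalues of `Ψ_S` are `0` and `s`. -/
theorem eigenvalues_psiMatrix {n : Pair K → ℕ} (hn : ∀ e, 0 < n e)
    (S : Submodule ℝ (Profile K)) (s : ℝ) (e : Pair K) :
    (psiMatrix_isHermitian n S s).eigenvalues e = 0 ∨
      (psiMatrix_isHermitian n S s).eigenvalues e = s := by
  set l := (psiMatrix_isHermitian n S s).eigenvalues e with hl
  set v := (psiMatrix_isHermitian n S s).eigenvectorBasis e with hv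
  have h := smul_residualProj_eigenvector hn S s e
  rw [← hl, ← hv] at h
  have hv0 : v ≠ 0 := (psiMatrix_isHermitian n S s).eigenvectorBasis.orthonormal.ne_zero e
  have hidem : residualProj n S (residualProj n S v) = residualProj n S v :=
    Submodule.starProjection_eq_self_iff.2 (Submodule.starProjection_apply_mem _ _)
  have h2 := congrArg (residualProj n S) h
  rw [map_smul, map_smul, hidem, h, ← sub_eq_zero] at h2
  by_cases hl0 : l = 0
  · exact Or.inl hl0
  right
  have h3 : (l * (s - l)) • v = 0 := by
    have h4 : s • (l • v) - s • (l • residualProj n S v) = (l * (s - l)) • v := by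
      rw [smul_comm s l (residualProj n S v), h, smul_smul, smul_smul, ← sub_smul]
      congr 1; ring
    rw [← h4, ← smul_sub, h2, smul_zero]
  have h4 := (smul_eq_zero.1 h3).resolve_right hv0
  have h5 := (mul_eq_zero.1 h4).resolve_left hl0
  linarith

/-- The lack-of-fit statistic is the squared length of the residual. -/
theorem lackOfFit_eq_norm {n : Pair K → ℕ} (hn : ∀ e, 0 < n e) (S : Submodule ℝ (Profile K))
    (Y : Pair K → ℕ → ℝ) :
    lackOfFit n S Y = ‖residualProj n S (scale n (pairMean n Y))‖ ^ 2 := by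
  rw [residualProj_apply, ← scale_fit n hn, ← map_sub, EuclideanSpace.norm_sq_eq, lackOfFit]
  exact Finset.sum_congr rfl fun e _ => by rw [Real.norm_eq_abs, sq_abs]; rfl

theorem lackOfFit_le_noiseEnergy {n : Pair K → ℕ} (hn : ∀ e, 0 < n e)
    {S : Submodule ℝ (Profile K)} {ν : Profile K} (hν : ν ∈ S) (Y : Pair K → ℕ → ℝ) :
    lackOfFit n S Y ≤ noiseEnergy n ν Y := by
  have h1 : residualProj n S (scale n ν) = 0 := by
    rw [residualProj_apply, sub_eq_zero]
    exact (Submodule.starProjection_eq_self_iff.2 (Submodule.mem_map_of_mem hν)).symm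
  have h2 : residualProj n S (scale n (pairMean n Y)) =
      residualProj n S (scale n (pairMean n Y - ν)) := by
    rw [map_sub, map_sub, h1, sub_zero]
  have h3 : noiseEnergy n ν Y = ‖scale n (pairMean n Y - ν)‖ ^ 2 := by
    rw [EuclideanSpace.norm_sq_eq, noiseEnergy]
    exact Finset.sum_congr rfl fun e _ => by simp [scale, mul_pow]
  rw [lackOfFit_eq_norm hn, h2, h3]
  exact pow_le_pow_left₀ (norm_nonneg _) (norm_residualProj_le n S _) 2

/-- The level of the lack-of-fit test: under the model its p-value is bounded below in terms of
`noiseEnergy`. -/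
theorem chiSqTail_le_lackOfFitPValue {M s : ℝ} (hs : 0 < s) {n : Pair K → ℕ} (hn : ∀ e, 0 < n e)
    {S : Submodule ℝ (Profile K)} {ν : Profile K} (hν : ν ∈ S) {Y : Pair K → ℕ → ℝ}
    (hM : noiseEnergy n ν Y ≤ M) (hvar : s ≤ varEst n Y) :
    chiSqTail (M / s) ≤ lackOfFitPValue n S Y := by
  have hl0 : ∀ e, 0 ≤ (psiMatrix_isHermitian n S (varEst n Y)).eigenvalues e := fun e => by
    rcases eigenvalues_psiMatrix hn S (varEst n Y) e with h | h <;> rw [h]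
    exact varEst_nonneg n Y
  by_cases h : ∀ e, (psiMatrix_isHermitian n S (varEst n Y)).eigenvalues e = 0
  · -- Here the residual projection vanishes, so the statistic is zero and the p-value is one.
    have h1 : ∀ x, residualProj n S x = 0 := by
      have h2 : (residualProj n S : Profile K →ₗ[ℝ] Profile K) = 0 := by
        refine (psiMatrix_isHermitian n S (varEst n Y)).eigenvectorBasis.toBasis.ext fun e => ?_
        have h3 := smul_residualProj_eigenvector hn S (varEst n Y) e
        rw [h e, zero_smul] at h3
        simpa using (smul_eq_zero.1 h3).resolve_left (hs.trans_le hvar).ne'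
      intro x
      exact LinearMap.congr_fun h2 x
    have h2 : {z : Pair K → ℝ | lackOfFit n S Y ≤
        ∑ e, (psiMatrix_isHermitian n S (varEst n Y)).eigenvalues e * z e ^ 2} = Set.univ := by
      refine Set.eq_univ_of_forall fun z => ?_
      rw [Set.mem_ofPred_eq, lackOfFit_eq_norm hn, h1]
      simp [h]
    rw [lackOfFitPValue, h2]
    simp [chiSqTail]
  · push Not at h
    obtain ⟨e, he⟩ := h
    have hes := (eigenvalues_psiMatrix hn S (varEst n Y) e).resolve_left he
    have h1 : chiSqTail (M / s) =
        (Measure.pi fun _ : Pair K => gaussianReal 0 1).real {z | M / s ≤ z e ^ 2} := by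
      have h2 := (measurePreserving_eval (fun _ : Pair K => gaussianReal 0 1) e).measure_preimage
        (s := {z | M / s ≤ z ^ 2})
        (measurableSet_le measurable_const (measurable_id.pow_const 2)).nullMeasurableSet
      rw [chiSqTail, Measure.real, ← h2]
      rfl
    rw [h1]
    refine measureReal_mono (fun z hz => ?_) (measure_ne_top _ _)
    simp only [Set.mem_ofPred_eq] at hz ⊢
    rw [div_le_iff₀ hs] at hz
    calc lackOfFit n S Y ≤ M := (lackOfFit_le_noiseEnergy hn hν Y).trans hM
      _ ≤ z e ^ 2 * varEst n Y := hz.trans (mul_le_mul_of_nonneg_left hvar (sq_nonneg _))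
      _ = (psiMatrix_isHermitian n S (varEst n Y)).eigenvalues e * z e ^ 2 := by
          rw [hes, mul_comm]
      _ ≤ _ := Finset.single_le_sum
          (f := fun e => (psiMatrix_isHermitian n S (varEst n Y)).eigenvalues e * z e ^ 2)
          (fun f _ => mul_nonneg (hl0 f) (sq_nonneg _)) (Finset.mem_univ e)

/-- The power of the lack-of-fit test: a false model is rejected as soon as the averages are
close to `ν` and the estimated variance is small in comparison with the numbers of comparisons. -/
theorem eventually_lackOfFitRejects {α : ℝ} (hα : 0 < α) {ν : Profile K}
    {S : Submodule ℝ (Profile K)} (hν : ν ∉ S) :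
    ∀ᶠ δ : ℝ in 𝓝[>] 0, ∀ (n : Pair K → ℕ) (Y : Pair K → ℕ → ℝ) (N : ℝ), 0 < N →
      (∀ e, N ≤ n e) → ‖pairMean n Y - ν‖ ≤ δ → varEst n Y ≤ δ * N →
      LackOfFitRejects α n S Y := by
  obtain ⟨q, hq, hq2⟩ := exists_measureReal_tail_le
    (Measure.pi fun _ : Pair K => gaussianReal 0 1) (f := fun z => ∑ e, z e ^ 2)
    (by fun_prop) hα
  obtain ⟨r, hr, hball⟩ := Metric.isOpen_iff.1
    (Submodule.closed_of_finiteDimensional S).isOpen_compl ν hν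
  have hsmall : 0 < min (r / 2) (r ^ 2 / (4 * q)) := by positivity
  filter_upwards [Ioc_mem_nhdsGT hsmall] with δ hδ n Y N hN hn hmean hvar
  obtain ⟨hδ0, hδ1⟩ := hδ
  have hn0 : ∀ e, 0 < n e := fun e => by exact_mod_cast hN.trans_le (hn e)
  have h1 : r ≤ dist (fit n S (pairMean n Y)) ν := by
    by_contra h
    exact hball (Metric.mem_ball.2 (not_le.1 h)) (fit_mem n hn0 S _)
  have h2 : r / 2 ≤ ‖pairMean n Y - fit n S (pairMean n Y)‖ := by
    have h3 := dist_triangle (fit n S (pairMean n Y)) (pairMean n Y) ν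
    rw [dist_comm (fit n S (pairMean n Y)) (pairMean n Y), dist_eq_norm (pairMean n Y),
      dist_eq_norm (pairMean n Y)] at h3
    have h5 := hδ1.trans (min_le_left _ _)
    linarith
  have h3 : N * (r / 2) ^ 2 ≤ lackOfFit n S Y := by
    calc N * (r / 2) ^ 2 ≤ N * ‖pairMean n Y - fit n S (pairMean n Y)‖ ^ 2 :=
          mul_le_mul_of_nonneg_left (pow_le_pow_left₀ (by positivity) h2 2) hN.le
      _ ≤ _ := by
        rw [EuclideanSpace.norm_sq_eq, Finset.mul_sum]
        refine Finset.sum_le_sum fun e _ => ?_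
        rw [mul_pow, Real.sq_sqrt (Nat.cast_nonneg _), PiLp.sub_apply, Real.norm_eq_abs, sq_abs]
        exact mul_le_mul_of_nonneg_right (hn e) (sq_nonneg _)
  have hR : 0 < lackOfFit n S Y := lt_of_lt_of_le (by positivity) h3
  have h4 : q * varEst n Y ≤ lackOfFit n S Y := by
    have h5 : δ * (4 * q) ≤ r ^ 2 :=
      (le_div_iff₀ (by positivity)).1 (hδ1.trans (min_le_right _ _))
    calc q * varEst n Y ≤ q * (δ * N) := mul_le_mul_of_nonneg_left hvar hq.le
      _ = N * (δ * (4 * q)) / 4 := by ring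
      _ ≤ N * r ^ 2 / 4 := by gcongr
      _ = N * (r / 2) ^ 2 := by ring
      _ ≤ _ := h3
  refine le_trans (measureReal_mono (fun z hz => ?_) (measure_ne_top _ _)) hq2
  simp only [Set.mem_ofPred_eq] at hz ⊢
  have h5 : ∑ e, (psiMatrix_isHermitian n S (varEst n Y)).eigenvalues e * z e ^ 2 ≤
      varEst n Y * ∑ e, z e ^ 2 := by
    rw [Finset.mul_sum]
    refine Finset.sum_le_sum fun e _ => mul_le_mul_of_nonneg_right ?_ (sq_nonneg _)
    rcases eigenvalues_psiMatrix hn0 S (varEst n Y) e with h | h <;> rw [h]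
    exact varEst_nonneg n Y
  have h6 := hz.trans h5
  have hv : 0 < varEst n Y := by
    refine lt_of_le_of_ne (varEst_nonneg n Y) fun h => ?_
    rw [← h, zero_mul] at h6
    exact absurd h6 hR.not_ge
  refine le_of_mul_le_mul_left (a := varEst n Y) ?_ hv
  rw [mul_comm]
  exact h4.trans h6

/-! ### Measurability of the tests -/

/-- The eigenvalues are listed in decreasing order, which a non-negative factor preserves. -/
theorem eigenvalues_smul {ι : Type*} [Fintype ι] [DecidableEq ι] {A : Matrix ι ι ℝ}
    (hA : A.IsHermitian) {s : ℝ} (hs : 0 ≤ s) (h : (s • A).IsHermitian) (i : ι) :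
    h.eigenvalues i = s * hA.eigenvalues i := by
  have hchar : (s • A).charpoly =
      ∏ i, (Polynomial.X - Polynomial.C (s * hA.eigenvalues i)) := by
    have h1 : s • A = Unitary.conjStarAlgAut ℝ (Matrix ι ι ℝ) hA.eigenvectorUnitary
        (Matrix.diagonal fun i => s * hA.eigenvalues i) := by
      conv_lhs => rw [hA.spectral_theorem]
      rw [← map_smul, ← Matrix.diagonal_smul]
      rfl
    rw [h1, Unitary.conjStarAlgAut_apply, Matrix.charpoly_mul_comm, ← mul_assoc]
    simp [Matrix.charpoly_diagonal]
  have hroots : (s • A).charpoly.roots =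
      Multiset.map (fun j => s * hA.eigenvalues₀ j) Finset.univ.val := by
    have h1 := hA.roots_charpoly_eq_eigenvalues.symm.trans hA.roots_charpoly_eq_eigenvalues₀
    have h2 := congrArg (Multiset.map (s * ·)) h1
    rw [Multiset.map_map, Multiset.map_map] at h2
    rw [hchar, Polynomial.roots_prod _ _
      (Finset.prod_ne_zero_iff.2 fun i _ => Polynomial.X_sub_C_ne_zero _)]
    simp only [Polynomial.roots_X_sub_C, Multiset.bind_singleton]
    exact h2
  have h0 : h.eigenvalues₀ = fun j => s * hA.eigenvalues₀ j := by
    rw [← List.ofFn_inj, ← h.sort_roots_charpoly_eq_eigenvalues₀, hroots]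
    simp_rw [Fin.univ_val_map, Multiset.map_coe, List.map_ofFn, Multiset.coe_sort]
    apply List.mergeSort_of_pairwise
    simp_rw [decide_eq_true_eq, ← List.sortedGE_iff_pairwise]
    exact Antitone.sortedGE_ofFn fun a b hab =>
      mul_le_mul_of_nonneg_left (hA.eigenvalues₀_antitone hab) hs
  simp [Matrix.IsHermitian.eigenvalues, h0]

theorem psiMatrix_eq_smul (n : Pair K → ℕ) (S : Submodule ℝ (Profile K)) (s : ℝ) :
    psiMatrix n S s = s • psiMatrix n S 1 := by
  simp [psiMatrix]

/-- The weights of the limit distribution are proportional to the estimated variance, with factors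
that do not depend on the data; this makes the p-value a measurable function of the data. -/
theorem eigenvalues_psiMatrix_eq (n : Pair K → ℕ) (S : Submodule ℝ (Profile K)) {s : ℝ}
    (hs : 0 ≤ s) (e : Pair K) : (psiMatrix_isHermitian n S s).eigenvalues e =
      s * (psiMatrix_isHermitian n S 1).eigenvalues e := by
  have h1 : (s • psiMatrix n S 1).IsHermitian :=
    psiMatrix_eq_smul n S s ▸ psiMatrix_isHermitian n S s
  have h2 : (psiMatrix_isHermitian n S s).eigenvalues = h1.eigenvalues := by
    rw [Matrix.IsHermitian.eigenvalues_eq_eigenvalues_iff, ← psiMatrix_eq_smul]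
  rw [h2, eigenvalues_smul (psiMatrix_isHermitian n S 1) hs]

theorem measurable_pairMean (n : Pair K → ℕ) : Measurable (pairMean n) := by
  refine (WithLp.measurable_toLp 2 _).comp (measurable_pi_lambda _ fun e => ?_)
  fun_prop

theorem measurable_pairMean_apply (n : Pair K → ℕ) (e : Pair K) :
    Measurable fun Y => pairMean n Y e := by
  unfold pairMean; fun_prop

theorem measurable_varEst (n : Pair K → ℕ) : Measurable (varEst n) := by
  have := measurable_pairMean_apply n
  unfold varEst; fun_prop

theorem measurable_pairPValue (n : Pair K → ℕ) (e : Pair K) :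
    Measurable fun Y => pairPValue n Y e := by
  have h1 : Measurable fun Y => cyclicPart (pairMean n Y) e := by
    have := measurable_pairMean_apply n
    simp_rw [cyclicPart_apply]
    fun_prop
  have h2 : Measurable fun Y => stdErr n Y e := by
    have := measurable_varEst n
    unfold stdErr
    fun_prop
  have h3 : MeasurableSet {x : (Pair K → ℕ → ℝ) × ℝ |
      |cyclicPart (pairMean n x.1) e| ≤ |x.2| * stdErr n x.1 e} :=
    measurableSet_le (h1.comp measurable_fst).abs
      (measurable_snd.abs.mul (h2.comp measurable_fst))
  exact (measurable_measure_prodMk_left (ν := gaussianReal 0 1) h3).ennreal_toReal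

theorem measurable_lackOfFit (n : Pair K → ℕ) (S : Submodule ℝ (Profile K)) :
    Measurable (lackOfFit n S) := by
  have h1 := measurable_pairMean_apply n
  have h2 : ∀ e, Measurable fun Y => fit n S (pairMean n Y) e := fun e => by
    have h3 : Measurable fun Y => scale n (pairMean n Y) :=
      (LinearMap.continuous_of_finiteDimensional (scale n)).measurable.comp (measurable_pairMean n)
    have h4 : Measurable fun Y => (S.map (scale n)).starProjection (scale n (pairMean n Y)) :=
      (ContinuousLinearMap.measurable _).comp h3
    have h5 : Measurable fun Y => (S.map (scale n)).starProjection (scale n (pairMean n Y)) e :=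
      (measurable_pi_apply e).comp ((WithLp.measurable_ofLp 2 _).comp h4)
    exact h5.const_mul _
  unfold lackOfFit
  fun_prop

theorem measurable_lackOfFitPValue (n : Pair K → ℕ) (S : Submodule ℝ (Profile K)) :
    Measurable (lackOfFitPValue n S) := by
  have h1 := measurable_lackOfFit n S
  have h2 := measurable_varEst n
  have h3 : MeasurableSet {x : (Pair K → ℕ → ℝ) × (Pair K → ℝ) | lackOfFit n S x.1 ≤
      ∑ e, varEst n x.1 * (psiMatrix_isHermitian n S 1).eigenvalues e * x.2 e ^ 2} :=
    measurableSet_le (by fun_prop) (by fun_prop)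
  have h4 := (measurable_measure_prodMk_left (ν := Measure.pi fun _ : Pair K => gaussianReal 0 1)
    h3).ennreal_toReal
  convert h4 using 2 with Y
  refine congrArg (fun s => ((Measure.pi fun _ : Pair K => gaussianReal 0 1) s).toReal) ?_
  ext z
  simp [eigenvalues_psiMatrix_eq n S (varEst_nonneg n Y)]

theorem measurableSet_lackOfFitRejects (α : ℝ) (n : Pair K → ℕ) (S : Submodule ℝ (Profile K)) :
    MeasurableSet {Y | LackOfFitRejects α n S Y} :=
  measurableSet_le (measurable_lackOfFitPValue n S) measurable_const

theorem measurableSet_rejects (rule : MultipleTesting) (α : ℝ) (n : Pair K → ℕ) (e : Pair K) :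
    MeasurableSet {Y | rule.Rejects α (pairPValue n Y) e} := by
  have hp := measurable_pairPValue n
  have hr : ∀ f, Measurable fun Y => α * (pRank (pairPValue n Y) f : ℝ) / (K.choose 2 : ℝ) := by
    intro f
    have : Measurable fun Y => (pRank (pairPValue n Y) f : ℝ) := by
      simp only [pRank, Finset.card_filter, Nat.cast_sum]
      refine Finset.measurable_sum _ fun g _ => ?_
      simp only [Nat.cast_ite, Nat.cast_one, Nat.cast_zero]
      exact Measurable.ite (measurableSet_le (hp g) (hp f)) measurable_const measurable_const
    fun_prop
  cases rule with
  | bonferroni => exact measurableSet_lt (hp e) measurable_const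
  | fdr => exact measurableSet_lt (hp e) (hr e)
  | fdrStepUp =>
    have : {Y | MultipleTesting.fdrStepUp.Rejects α (pairPValue n Y) e} =
        ⋃ f, {Y | pairPValue n Y e ≤ pairPValue n Y f} ∩
          {Y | pairPValue n Y f < α * (pRank (pairPValue n Y) f : ℝ) / (K.choose 2 : ℝ)} := by
      ext Y
      simp [MultipleTesting.Rejects]
    rw [this]
    exact MeasurableSet.iUnion fun f =>
      (measurableSet_le (hp e) (hp f)).inter (measurableSet_lt (hp f) (hr f))

/-! ### Behaviour of the averages and of the variance estimator -/

/-- The errors `ε e k` are independent and identically distributed, with mean zero and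
variance `σ ^ 2`. -/
structure IsErrorModel {Ω : Type*} [MeasurableSpace Ω] (P : Measure Ω) (ε : Pair K → ℕ → Ω → ℝ)
    (σ : ℝ) : Prop where
  indep : iIndepFun (fun q : Pair K × ℕ => ε q.1 q.2) P
  ident : ∀ q r : Pair K × ℕ, IdentDistrib (ε q.1 q.2) (ε r.1 r.2) P P
  memLp : ∀ e k, MemLp (ε e k) 2 P
  mean : ∀ e k, ∫ ω, ε e k ω ∂P = 0
  var : ∀ e k, variance (ε e k) P = σ ^ 2

theorem pairMean_outcomes_sub {Ω : Type*} (ν : Profile K) (ε : Pair K → ℕ → Ω → ℝ) (ω : Ω)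
    (n : Pair K → ℕ) {e : Pair K} (hn : 0 < n e) :
    pairMean n (outcomes ν ε ω) e - ν e = (∑ k ∈ Finset.range (n e), ε e k ω) / n e := by
  have : (n e : ℝ) ≠ 0 := by exact_mod_cast hn.ne'
  simp only [pairMean, outcomes, Finset.sum_add_distrib, Finset.sum_const, Finset.card_range,
    nsmul_eq_mul]
  field_simp
  ring

/-- The variance estimator is a weighted mean of the empirical variances of the pairs. -/
theorem varEst_outcomes {Ω : Type*} (ν : Profile K) (ε : Pair K → ℕ → Ω → ℝ) (ω : Ω)
    (n : Pair K → ℕ) (hn : ∀ e, 0 < n e) :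
    varEst n (outcomes ν ε ω) = (∑ e, (n e : ℝ) *
      ((∑ k ∈ Finset.range (n e), ε e k ω ^ 2) / n e -
        ((∑ k ∈ Finset.range (n e), ε e k ω) / n e) ^ 2)) / total n := by
  unfold varEst
  congr 1
  refine Finset.sum_congr rfl fun e _ => ?_
  have hne : (n e : ℝ) ≠ 0 := by exact_mod_cast (hn e).ne'
  have h1 := pairMean_outcomes_sub ν ε ω n (hn e)
  set a := (∑ k ∈ Finset.range (n e), ε e k ω) / n e with ha
  have hsum : ∑ k ∈ Finset.range (n e), ε e k ω = n e * a := by rw [ha]; field_simp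
  have h2 : ∀ k, outcomes ν ε ω e k - pairMean n (outcomes ν ε ω) e = ε e k ω - a := by
    intro k
    simp only [outcomes] at h1 ⊢
    linarith
  simp_rw [h2, sub_sq, Finset.sum_add_distrib, Finset.sum_sub_distrib, ← Finset.sum_mul,
    ← Finset.mul_sum, hsum]
  simp only [Finset.sum_const, Finset.card_range, nsmul_eq_mul]
  field_simp
  ring

theorem total_eq (n : Pair K → ℕ) : (total n : ℝ) = ∑ e, (n e : ℝ) := by
  simp [total]

theorem total_pos [Nonempty (Pair K)] {n : Pair K → ℕ} (hn : ∀ e, 0 < n e) :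
    (0 : ℝ) < total n := by
  rw [total_eq]
  exact Finset.sum_pos (fun e _ => by exact_mod_cast hn e) Finset.univ_nonempty

section

variable {Ω : Type*} [MeasurableSpace Ω] {P : Measure Ω} {ε : Pair K → ℕ → Ω → ℝ} {σ : ℝ}

theorem IsErrorModel.indepFun (h : IsErrorModel P ε σ) (e : Pair K) {i j : ℕ} (hij : i ≠ j) :
    IndepFun (ε e i) (ε e j) P :=
  h.indep.indepFun (i := (e, i)) (j := (e, j)) (by simpa using hij)

theorem IsErrorModel.aemeasurable_outcomes (h : IsErrorModel P ε σ) (ν : Profile K) :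
    AEMeasurable (outcomes ν ε) P := by
  refine aemeasurable_pi_lambda _ fun e => aemeasurable_pi_lambda _ fun k => ?_
  exact (h.memLp e k).aestronglyMeasurable.aemeasurable.const_add _

theorem IsErrorModel.integral_sq [IsProbabilityMeasure P] (h : IsErrorModel P ε σ) (e : Pair K)
    (k : ℕ) : ∫ ω, ε e k ω ^ 2 ∂P = σ ^ 2 := by
  rw [← h.var e k, variance_of_integral_eq_zero (h.memLp e k).aestronglyMeasurable.aemeasurable
    (h.mean e k)]

theorem IsErrorModel.ae_tendsto_avg [IsProbabilityMeasure P] (h : IsErrorModel P ε σ) :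
    ∀ᵐ ω ∂P, ∀ e, Tendsto (fun N : ℕ => (∑ k ∈ Finset.range N, ε e k ω) / N) atTop (𝓝 0) := by
  refine ae_all_iff.2 fun e => ?_
  have := strong_law_ae_real (ε e) ((h.memLp e 0).integrable (by norm_num))
    (fun i j hij => h.indepFun e hij) (fun i => h.ident (e, i) (e, 0))
  rwa [h.mean] at this

theorem IsErrorModel.ae_tendsto_sqAvg [IsProbabilityMeasure P] (h : IsErrorModel P ε σ) :
    ∀ᵐ ω ∂P, ∀ e,
      Tendsto (fun N : ℕ => (∑ k ∈ Finset.range N, ε e k ω ^ 2) / N) atTop (𝓝 (σ ^ 2)) := by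
  refine ae_all_iff.2 fun e => ?_
  have hm : Measurable fun x : ℝ => x ^ 2 := measurable_id.pow_const 2
  have := strong_law_ae_real (fun k ω => ε e k ω ^ 2) (h.memLp e 0).integrable_sq
    (fun i j hij => (h.indepFun e hij).comp hm hm) (fun i => (h.ident (e, i) (e, 0)).comp hm)
  rwa [h.integral_sq] at this

theorem IsErrorModel.ae_eventually_norm_le [IsProbabilityMeasure P] (h : IsErrorModel P ε σ)
    (ν : Profile K) {n : ℕ → Pair K → ℕ} (hn : ∀ e, Tendsto (fun m => n m e) atTop atTop)
    {δ : ℝ} (hδ : 0 < δ) :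
    ∀ᵐ ω ∂P, ∀ᶠ m in atTop, ‖pairMean (n m) (outcomes ν ε ω) - ν‖ ≤ δ := by
  filter_upwards [h.ae_tendsto_avg] with ω hω
  have h1 : Tendsto (fun m => pairMean (n m) (outcomes ν ε ω) - ν) atTop (𝓝 0) := by
    have h2 : Tendsto (fun m e => (pairMean (n m) (outcomes ν ε ω) - ν) e) atTop
        (𝓝 (0 : Pair K → ℝ)) := by
      refine tendsto_pi_nhds.2 fun e => ((hω e).comp (hn e)).congr' ?_
      filter_upwards [(hn e).eventually_gt_atTop 0] with m hm
      exact (pairMean_outcomes_sub ν ε ω (n m) hm).symm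
    exact ((PiLp.continuous_toLp 2 _).tendsto _).comp h2
  have h3 := (tendsto_norm_zero.comp h1).eventually (gt_mem_nhds hδ)
  filter_upwards [h3] with m hm using le_of_lt hm

theorem IsErrorModel.ae_eventually_varEst [IsProbabilityMeasure P] [Nonempty (Pair K)]
    (h : IsErrorModel P ε σ) (hσ : 0 < σ)
    (ν : Profile K) {n : ℕ → Pair K → ℕ} (hn : ∀ e, Tendsto (fun m => n m e) atTop atTop) :
    ∀ᵐ ω ∂P, ∀ᶠ m in atTop, σ ^ 2 / 2 ≤ varEst (n m) (outcomes ν ε ω) ∧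
      varEst (n m) (outcomes ν ε ω) ≤ 2 * σ ^ 2 := by
  filter_upwards [h.ae_tendsto_avg, h.ae_tendsto_sqAvg] with ω h1 h2
  have hpos : 0 < σ ^ 2 := by positivity
  have h3 : ∀ᶠ m in atTop, ∀ e, 0 < n m e ∧
      σ ^ 2 / 2 ≤ ((∑ k ∈ Finset.range (n m e), ε e k ω ^ 2) / n m e -
        ((∑ k ∈ Finset.range (n m e), ε e k ω) / n m e) ^ 2) ∧
      ((∑ k ∈ Finset.range (n m e), ε e k ω ^ 2) / n m e -
        ((∑ k ∈ Finset.range (n m e), ε e k ω) / n m e) ^ 2) ≤ 2 * σ ^ 2 := by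
    refine eventually_all.2 fun e => ?_
    have h4 := ((h2 e).sub ((h1 e).pow 2)).comp (hn e)
    filter_upwards [(hn e).eventually_gt_atTop 0,
      h4.eventually (Icc_mem_nhds (a := σ ^ 2 / 2) (b := 2 * σ ^ 2) (by linarith) (by linarith))]
      with m hm hm2
    exact ⟨hm, hm2.1, hm2.2⟩
  filter_upwards [h3] with m hm
  have htot := total_pos fun e => (hm e).1
  rw [varEst_outcomes ν ε ω (n m) fun e => (hm e).1, le_div_iff₀ htot, div_le_iff₀ htot, total_eq,
    Finset.mul_sum, Finset.mul_sum]
  constructor <;> refine Finset.sum_le_sum fun e _ => ?_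
  · rw [mul_comm]; exact mul_le_mul_of_nonneg_left (hm e).2.1 (Nat.cast_nonneg _)
  · rw [mul_comm (2 * σ ^ 2)]; exact mul_le_mul_of_nonneg_left (hm e).2.2 (Nat.cast_nonneg _)

/-- The sums of squares `∑ n_e (S̄_e - ν_e)²` are bounded in probability. -/
theorem IsErrorModel.noiseEnergy_tail [IsProbabilityMeasure P] (h : IsErrorModel P ε σ)
    (ν : Profile K) {n : Pair K → ℕ} (hn : ∀ e, 0 < n e) {M : ℝ} (hM : 0 < M) :
    P.real {ω | M ≤ noiseEnergy n ν (outcomes ν ε ω)} ≤ Fintype.card (Pair K) * σ ^ 2 / M := by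
  have hL : ∀ e, MemLp (∑ k ∈ Finset.range (n e), ε e k) 2 P := fun e =>
    memLp_finsetSum' _ fun k _ => h.memLp e k
  have hsq : ∀ e, ∫ ω, (∑ k ∈ Finset.range (n e), ε e k) ω ^ 2 ∂P = n e * σ ^ 2 := by
    intro e
    rw [← variance_of_integral_eq_zero (hL e).aestronglyMeasurable.aemeasurable,
      IndepFun.variance_sum (fun k _ => h.memLp e k) fun i _ j _ hij => h.indepFun e hij]
    · simp [h.var]
    · simp only [Finset.sum_apply]
      rw [integral_finsetSum _ fun k _ => (h.memLp e k).integrable (by norm_num)]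
      simp [h.mean]
  have heq : ∀ ω, noiseEnergy n ν (outcomes ν ε ω) =
      ∑ e, (n e : ℝ)⁻¹ * (∑ k ∈ Finset.range (n e), ε e k) ω ^ 2 := by
    intro ω
    refine Finset.sum_congr rfl fun e _ => ?_
    have : (n e : ℝ) ≠ 0 := by exact_mod_cast (hn e).ne'
    rw [pairMean_outcomes_sub ν ε ω n (hn e), Finset.sum_apply]
    field_simp
  have hint : ∀ e, Integrable (fun ω => (n e : ℝ)⁻¹ *
      (∑ k ∈ Finset.range (n e), ε e k) ω ^ 2) P := fun e => (hL e).integrable_sq.const_mul _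
  have h1 := mul_meas_ge_le_integral_of_nonneg (μ := P)
    (f := fun ω => ∑ e, (n e : ℝ)⁻¹ * (∑ k ∈ Finset.range (n e), ε e k) ω ^ 2)
    (ae_of_all _ fun ω => Finset.sum_nonneg fun e _ => by positivity)
    (integrable_finsetSum _ fun e _ => hint e) M
  rw [integral_finsetSum _ fun e _ => hint e] at h1
  simp_rw [integral_const_mul, hsq, ← heq] at h1
  rw [le_div_iff₀ hM, mul_comm]
  refine h1.trans (le_of_eq ?_)
  rw [Finset.sum_congr rfl (g := fun _ => σ ^ 2)]
  · simp
  · intro e _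
    have : (n e : ℝ) ≠ 0 := by exact_mod_cast (hn e).ne'
    field_simp

/-! ### Convergence of probabilities -/

/-- Events that almost surely occur eventually have probability tending to one. No measurability
is needed, since outer measures are continuous along increasing sequences. -/
theorem tendsto_measureReal_one_of_ae_eventually [IsProbabilityMeasure P] {A : ℕ → Ω → Prop}
    (h : ∀ᵐ ω ∂P, ∀ᶠ m in atTop, A m ω) :
    Tendsto (fun m => P.real {ω | A m ω}) atTop (𝓝 1) := by
  have h1 : P (⋃ m : ℕ, {ω | ∀ k, m ≤ k → A k ω}) = 1 := by
    rw [← measure_univ (μ := P)]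
    refine measure_congr ?_
    filter_upwards [h] with ω hω
    refine propext ⟨fun _ => trivial, fun _ => ?_⟩
    obtain ⟨m, hm⟩ := eventually_atTop.1 hω
    exact Set.mem_iUnion.2 ⟨m, hm⟩
  have h2 : Tendsto (fun m : ℕ => P {ω | ∀ k, m ≤ k → A k ω}) atTop (𝓝 1) := by
    rw [← h1]
    exact tendsto_measure_iUnion_atTop fun a b hab ω hω k hk => hω k (hab.trans hk)
  have h3 := (ENNReal.tendsto_toReal ENNReal.one_ne_top).comp h2
  refine tendsto_of_tendsto_of_tendsto_of_le_of_le h3 tendsto_const_nhds (fun m => ?_)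
    (fun m => measureReal_le_one)
  exact measureReal_mono (fun ω hω => hω m le_rfl) (measure_ne_top _ _)

theorem tendsto_measureReal_compl [IsProbabilityMeasure P] {A : ℕ → Set Ω}
    (hA : ∀ m, NullMeasurableSet (A m) P) (h : Tendsto (fun m => P.real (A m)) atTop (𝓝 1)) :
    Tendsto (fun m => P.real (A m)ᶜ) atTop (𝓝 0) := by
  simp_rw [fun m => probReal_compl_eq_one_sub₀ (hA m)]
  simpa using h.const_sub 1

theorem one_sub_le_measureReal [IsProbabilityMeasure P] (A : Set Ω) :
    1 - P.real Aᶜ ≤ P.real A := by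
  have := measureReal_union_le (μ := P) A Aᶜ
  rw [Set.union_compl_self, probReal_univ] at this
  linarith

/-! ### Exponential bounds for sub-Gaussian errors -/

theorem _root_.ProbabilityTheory.HasSubgaussianMGF.mono {X : Ω → ℝ} {c d : ℝ≥0}
    (h : HasSubgaussianMGF X c P) (hcd : c ≤ d) : HasSubgaussianMGF X d P where
  integrable_exp_mul := h.integrable_exp_mul
  mgf_le t := (h.mgf_le t).trans (by gcongr)

theorem _root_.ProbabilityTheory.HasSubgaussianMGF.measure_abs_ge_le [IsFiniteMeasure P]
    {X : Ω → ℝ} {c : ℝ≥0}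
    (h : HasSubgaussianMGF X c P) {x : ℝ} (hx : 0 ≤ x) :
    P.real {ω | x ≤ |X ω|} ≤ 2 * Real.exp (-x ^ 2 / (2 * c)) := by
  have h1 : {ω | x ≤ |X ω|} ⊆ {ω | x ≤ X ω} ∪ {ω | x ≤ (-X) ω} := fun ω hω => by
    simpa [le_abs] using hω
  calc P.real {ω | x ≤ |X ω|} ≤ P.real ({ω | x ≤ X ω} ∪ {ω | x ≤ (-X) ω}) :=
        measureReal_mono h1 (measure_ne_top _ _)
    _ ≤ _ := measureReal_union_le _ _
    _ ≤ _ := by linarith [h.measure_ge_le hx, h.neg.measure_ge_le hx]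

theorem norm_le_of_apply_le {x : Profile K} {δ : ℝ} (h : ∀ e, |x e| ≤ δ) :
    ‖x‖ ≤ Fintype.card (Pair K) * δ := by
  have h1 : ‖x‖ ≤ ∑ e, ‖x e‖ := by
    have h2 : x = ∑ f, x f • EuclideanSpace.single f (1 : ℝ) := by
      ext e; simp [WithLp.ofLp_sum, Finset.sum_apply, Pi.single_apply]
    conv_lhs => rw [h2]
    refine (norm_sum_le _ _).trans (Finset.sum_le_sum fun e _ => ?_)
    rw [norm_smul]
    simp
  refine h1.trans ((Finset.sum_le_sum fun e _ => h e).trans ?_)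
  simp

/-- If the variance estimator is of the order of the number of comparisons, then some error is
of the order of its square root; so for sub-Gaussian errors a union bound over the individual
errors shows that this event, too, has exponentially small probability. -/
theorem IsErrorModel.exponential_bound [IsProbabilityMeasure P] [Nonempty (Pair K)]
    (h : IsErrorModel P ε σ) (ν : Profile K) {τ : ℝ≥0}
    (hτ : ∀ e k, HasSubgaussianMGF (ε e k) τ P) {c δ : ℝ} (hc : 0 < c) (hδ : 0 < δ) :
    ∃ C₁ C₂ : ℝ, 0 < C₁ ∧ 0 < C₂ ∧ ∀ n : Pair K → ℕ, (∀ e, 0 < n e) →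
      (∀ e, c * (total n : ℝ) ≤ n e) →
      P.real {ω | ‖pairMean n (outcomes ν ε ω) - ν‖ ≤ δ ∧
        varEst n (outcomes ν ε ω) ≤ δ * (c * total n)}ᶜ ≤
      C₁ * Real.exp (-(C₂ * (total n : ℝ))) := by
  -- The proxy `τ + 1` is positive, so that division by it is not degenerate.
  have hτ' : ∀ e k, HasSubgaussianMGF (ε e k) (τ + 1) P := fun e k => (hτ e k).mono (by simp)
  have hτpos : (0 : ℝ) < 2 * ((τ + 1 : ℝ≥0) : ℝ) := by positivity
  set t : ℝ := 2 * ((τ + 1 : ℝ≥0) : ℝ) with ht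
  set p : ℝ := (Fintype.card (Pair K) : ℝ) with hp
  have hp0 : 0 < p := by rw [hp]; exact_mod_cast Fintype.card_pos
  set d : ℝ := δ / p with hd
  have hd0 : 0 < d := div_pos hδ hp0
  set a : ℝ := c * d ^ 2 / t with ha
  set b : ℝ := δ * c / t with hb
  have ha0 : 0 < a := by positivity
  have hb0 : 0 < b := by positivity
  refine ⟨2 * p + 4 / b, min a (b / 2), by positivity, by positivity, fun n hn hcn => ?_⟩
  have htot := total_pos hn
  have hsub : {ω | ‖pairMean n (outcomes ν ε ω) - ν‖ ≤ δ ∧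
      varEst n (outcomes ν ε ω) ≤ δ * (c * total n)}ᶜ ⊆
      (⋃ e, {ω | n e * d ≤ |∑ k ∈ Finset.range (n e), ε e k ω|}) ∪
      ⋃ e, ⋃ k ∈ Finset.range (n e), {ω | √(δ * (c * total n)) ≤ |ε e k ω|} := by
    intro ω hω
    by_contra hnot
    simp only [Set.mem_union, Set.mem_iUnion, Set.mem_ofPred_eq, not_or, not_exists, not_le,
      Finset.mem_range] at hnot
    refine hω ⟨?_, ?_⟩
    · have h1 : ∀ e, |(pairMean n (outcomes ν ε ω) - ν) e| ≤ d := by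
        intro e
        have hne : (0 : ℝ) < n e := by exact_mod_cast hn e
        rw [PiLp.sub_apply, pairMean_outcomes_sub ν ε ω n (hn e), abs_div, abs_of_pos hne,
          div_le_iff₀ hne, mul_comm]
        exact (hnot.1 e).le
      refine (norm_le_of_apply_le h1).trans (le_of_eq ?_)
      rw [← hp, hd]
      field_simp
    · rw [varEst_outcomes ν ε ω n hn, div_le_iff₀ htot, total_eq, Finset.mul_sum]
      refine Finset.sum_le_sum fun e _ => ?_
      have hne : (0 : ℝ) < n e := by exact_mod_cast hn e
      rw [mul_comm _ (n e : ℝ)]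
      refine mul_le_mul_of_nonneg_left ?_ hne.le
      refine (sub_le_self _ (sq_nonneg _)).trans ?_
      rw [div_le_iff₀ hne, ← total_eq]
      have h2 : ∀ k ∈ Finset.range (n e), ε e k ω ^ 2 ≤ δ * (c * total n) := by
        intro k hk
        have h3 := (hnot.2 e k (Finset.mem_range.1 hk)).le
        rw [← sq_abs, ← Real.sq_sqrt (show 0 ≤ δ * (c * total n) by positivity)]
        exact pow_le_pow_left₀ (abs_nonneg _) h3 2
      refine (Finset.sum_le_sum h2).trans (le_of_eq ?_)
      simp [mul_comm]
  have h1 : ∀ e, P.real {ω | n e * d ≤ |∑ k ∈ Finset.range (n e), ε e k ω|} ≤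
      2 * Real.exp (-(a * total n)) := by
    intro e
    have hne : (0 : ℝ) < n e := by exact_mod_cast hn e
    have hind : iIndepFun (ε e) P :=
      h.indep.precomp (g := fun k : ℕ => (e, k)) fun i j hij => by simpa using hij
    have h2 := (HasSubgaussianMGF.sum_of_iIndepFun hind (s := Finset.range (n e))
      (c := fun _ => τ + 1) fun k _ => hτ' e k).measure_abs_ge_le
      (x := n e * d) (by positivity)
    refine h2.trans ?_
    gcongr
    have h3 : ((∑ k ∈ Finset.range (n e), (τ + 1 : ℝ≥0) : ℝ≥0) : ℝ) =
        n e * ((τ + 1 : ℝ≥0) : ℝ) := by simp [mul_add]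
    rw [h3, neg_div, neg_le_neg_iff]
    have h4 : (n e * d) ^ 2 / (2 * (n e * ((τ + 1 : ℝ≥0) : ℝ))) = n e * d ^ 2 / t := by
      rw [ht]; field_simp
    rw [h4, ha, div_mul_eq_mul_div]
    refine div_le_div_of_nonneg_right ?_ hτpos.le
    calc c * d ^ 2 * total n = (c * total n) * d ^ 2 := by ring
      _ ≤ _ := mul_le_mul_of_nonneg_right (hcn e) (sq_nonneg d)
  have h2 : ∀ e k, P.real {ω | √(δ * (c * total n)) ≤ |ε e k ω|} ≤
      2 * Real.exp (-(b * total n)) := by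
    intro e k
    refine ((hτ' e k).measure_abs_ge_le (Real.sqrt_nonneg _)).trans (le_of_eq ?_)
    rw [Real.sq_sqrt (by positivity), ← ht, hb]
    congr 2
    ring
  have h3 : P.real (⋃ e, {ω | n e * d ≤ |∑ k ∈ Finset.range (n e), ε e k ω|}) ≤
      p * (2 * Real.exp (-(a * total n))) := by
    refine (measureReal_iUnion_fintype_le _).trans ((Finset.sum_le_sum fun e _ => h1 e).trans ?_)
    simp [hp]
  have h4 : P.real (⋃ e, ⋃ k ∈ Finset.range (n e), {ω | √(δ * (c * total n)) ≤ |ε e k ω|}) ≤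
      total n * (2 * Real.exp (-(b * total n))) := by
    refine (measureReal_iUnion_fintype_le _).trans ?_
    rw [total_eq, Finset.sum_mul]
    refine Finset.sum_le_sum fun e _ => ?_
    refine (measureReal_biUnion_finset_le _ _).trans ?_
    rw [← total_eq]
    refine (Finset.sum_le_sum fun k _ => h2 e k).trans ?_
    simp
  -- The factor `total n` of the union bound is absorbed by half of the exponent.
  have h5 : total n * Real.exp (-(b * total n)) ≤ 2 / b * Real.exp (-(b / 2 * total n)) := by
    have h6 : b / 2 * total n ≤ Real.exp (b / 2 * total n) :=
      (le_add_of_nonneg_right zero_le_one).trans (Real.add_one_le_exp _)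
    have h7 : Real.exp (-(b * total n)) =
        Real.exp (-(b / 2 * total n)) * Real.exp (-(b / 2 * total n)) := by
      rw [← Real.exp_add]; congr 1; ring
    have h8 : b / 2 * total n * Real.exp (-(b / 2 * total n)) ≤ 1 := by
      rw [Real.exp_neg, ← div_eq_mul_inv]
      exact div_le_one_of_le₀ h6 (Real.exp_pos _).le
    rw [h7]
    calc total n * (Real.exp (-(b / 2 * total n)) * Real.exp (-(b / 2 * total n)))
        = 2 / b * (b / 2 * total n * Real.exp (-(b / 2 * total n))) *
            Real.exp (-(b / 2 * total n)) := by field_simp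
      _ ≤ 2 / b * 1 * Real.exp (-(b / 2 * total n)) := by gcongr
      _ = _ := by ring
  have h6 : Real.exp (-(a * total n)) ≤ Real.exp (-(min a (b / 2) * total n)) := by
    gcongr; exact min_le_left _ _
  have h7 : Real.exp (-(b / 2 * total n)) ≤ Real.exp (-(min a (b / 2) * total n)) := by
    gcongr; exact min_le_right _ _
  calc _ ≤ _ := measureReal_mono hsub (measure_ne_top _ _)
    _ ≤ _ := measureReal_union_le _ _
    _ ≤ p * (2 * Real.exp (-(a * total n))) + total n * (2 * Real.exp (-(b * total n))) :=
        add_le_add h3 h4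
    _ = 2 * p * Real.exp (-(a * total n)) + 2 * (total n * Real.exp (-(b * total n))) := by ring
    _ ≤ 2 * p * Real.exp (-(min a (b / 2) * total n)) +
        2 * (2 / b * Real.exp (-(min a (b / 2) * total n))) := by
        refine add_le_add (mul_le_mul_of_nonneg_left h6 (by positivity))
          (mul_le_mul_of_nonneg_left (h5.trans ?_) (by positivity))
        exact mul_le_mul_of_nonneg_left h7 (by positivity)
    _ = _ := by ring

end

/-! ### The selected model when the tests are correct -/

/-- If all false null hypotheses are rejected, then the selected model contains the cyclic part:
a selected model among the first three was accepted, hence is true, and otherwise all pairs of the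
support are ticked. -/
theorem cyclicPart_mem_ftbs {rule : MultipleTesting} {lin : Finset (Triad K) → Finset (Triad K)}
    (hlin : IsBasisChoice lin) {α : ℝ} (h0 : 0 < α) (h1 : α < 1) {ν : Profile K}
    {n : Pair K → ℕ} {Y : Pair K → ℕ → ℝ}
    (hpair : ∀ e, cyclicPart ν e ≠ 0 → rule.Rejects α (pairPValue n Y) e)
    (hfit : ∀ T : Finset (Triad K), ν ∉ modelSpan T → LackOfFitRejects α n (modelSpan T) Y) :
    cyclicPart ν ∈ modelSpan (ftbs rule lin α n Y) := by
  have hacc : ∀ T : Finset (Triad K), ¬ LackOfFitRejects α n (modelSpan T) Y →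
      cyclicPart ν ∈ modelSpan T := fun T hT =>
    cyclicPart_mem_modelSpan_iff.2 (not_imp_comm.1 (hfit T) hT)
  unfold ftbs
  split_ifs with h2 h3 h4
  · exact cyclicPart_mem_candidate₄ hlin ν _ fun e he =>
      (cyclicStar_ne_zero_iff h0 h1).2 (hpair e he)
  · exact hacc _ h4
  · exact hacc _ h3
  · exact hacc _ h2

/-- If all tests are correct and the triads of a minimal model are as in the assumptions, then
exactly these triads are selected. -/
theorem ftbs_eq_modelTriads {rule : MultipleTesting}
    {lin : Finset (Triad K) → Finset (Triad K)}
    (hlin : IsBasisChoice lin) {α : ℝ} (h0 : 0 < α) (h1 : α < 1) {ν : Profile K}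
    {n : Pair K → ℕ} {Y : Pair K → ℕ → ℝ}
    (hpair : ∀ e, rule.Rejects α (pairPValue n Y) e ↔ cyclicPart ν e ≠ 0)
    (hfit : ∀ T : Finset (Triad K), LackOfFitRejects α n (modelSpan T) Y ↔ ν ∉ modelSpan T)
    {γ : Triad K → ℝ} (hγ : IsMinimalModel γ ν)
    (hdis : ∀ t ∈ modelTriads γ, ∀ u ∈ modelTriads γ, t ≠ u → (t.items ∩ u.items).card ≤ 1)
    (hcl : ∀ t : Triad K, (∀ e ∈ t.pairs, ∃ u ∈ modelTriads γ, e ∈ u.pairs) →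
      t ∈ modelTriads γ) :
    ftbs rule lin α n Y = modelTriads γ := by
  have hcand : candidate₂ lin (cyclicStar rule α n Y) = modelTriads γ := by
    rw [candidate₂, ticked_three_eq hγ.1 hdis hcl fun e =>
      (cyclicStar_ne_zero_iff h0 h1).trans (hpair e), lin_modelTriads hdis hlin]
  have hacc : ¬ LackOfFitRejects α n (modelSpan (modelTriads γ)) Y := fun h =>
    (hfit _).1 h hγ.1.mem_modelSpan
  unfold ftbs
  rw [hcand]
  by_cases h2 : LackOfFitRejects α n (modelSpan ∅) Y
  · rw [if_neg (not_not.2 h2), if_pos hacc]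
  · rw [if_pos h2]
    have hν : ν ∈ modelSpan (∅ : Finset (Triad K)) := not_imp_comm.1 (hfit _).2 h2
    -- The cyclic part is both cyclic and linear, hence zero, and has the empty representation.
    have hν0 : cyclicPart ν = 0 := by
      have h3 : cyclicPart ν ∈ linearSpace K := by
        simpa [modelSpan, triadSpan] using cyclicPart_mem_modelSpan_iff.2 hν
      exact inner_self_eq_zero (𝕜 := ℝ).1
        (Submodule.inner_right_of_mem_orthogonal h3 (cyclicPart_mem_orthogonal ν))
    have h3 := hγ.2 0 (by simp [Represents, hν0])
    have h4 : modelTriads (0 : Triad K → ℝ) = ∅ := by simp [modelTriads]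
    rw [h4, Finset.card_empty, Nat.le_zero, Finset.card_eq_zero] at h3
    exact h3.symm

/-- The deterministic part of consistency: a neighbourhood of `ν` for the averages, and a bound
for the estimated variance relative to the numbers of comparisons, that ensure a correct model. -/
theorem exists_cyclicPart_mem_ftbs (rule : MultipleTesting)
    {lin : Finset (Triad K) → Finset (Triad K)} (hlin : IsBasisChoice lin)
    {α : ℝ} (h0 : 0 < α) (h1 : α < 1) (ν : Profile K) :
    ∃ δ : ℝ, 0 < δ ∧ ∀ (n : Pair K → ℕ) (Y : Pair K → ℕ → ℝ) (N : ℝ), 0 < N →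
      (∀ e, N ≤ n e) → ‖pairMean n Y - ν‖ ≤ δ → varEst n Y ≤ δ * N →
      cyclicPart ν ∈ modelSpan (ftbs rule lin α n Y) := by
  have hp : ∀ᶠ δ : ℝ in 𝓝[>] 0, ∀ e : Pair K, cyclicPart ν e ≠ 0 →
      ∀ (n : Pair K → ℕ) (Y : Pair K → ℕ → ℝ) (N : ℝ), 0 < N →
      (∀ e, N ≤ n e) → ‖pairMean n Y - ν‖ ≤ δ → varEst n Y ≤ δ * N →
      rule.Rejects α (pairPValue n Y) e :=
    eventually_all.2 fun e => eventually_imp_distrib_left.2 fun he =>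
      eventually_rejects rule h0 ν he
  have hf : ∀ᶠ δ : ℝ in 𝓝[>] 0, ∀ T : Finset (Triad K), ν ∉ modelSpan T →
      ∀ (n : Pair K → ℕ) (Y : Pair K → ℕ → ℝ) (N : ℝ), 0 < N →
      (∀ e, N ≤ n e) → ‖pairMean n Y - ν‖ ≤ δ → varEst n Y ≤ δ * N →
      LackOfFitRejects α n (modelSpan T) Y :=
    eventually_all.2 fun T => eventually_imp_distrib_left.2 fun hT =>
      eventually_lackOfFitRejects h0 hT
  obtain ⟨δ, ⟨h2, h3⟩, h4⟩ := ((hp.and hf).and self_mem_nhdsWithin).exists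
  exact ⟨δ, h4, fun n Y N hN hn hm hv => cyclicPart_mem_ftbs hlin h0 h1
    (fun e he => h2 e he n Y N hN hn hm hv) fun T hT => h3 T hT n Y N hN hn hm hv⟩

/-! ### The three asymptotic statements -/

section

variable {Ω : Type*} [MeasurableSpace Ω] {P : Measure Ω} [IsProbabilityMeasure P]
  {ε : Pair K → ℕ → Ω → ℝ} {σ : ℝ}

/-- Almost surely all false null hypotheses are eventually rejected: the averages converge to `ν`,
and the estimated variance stays bounded while the numbers of comparisons diverge. -/
theorem IsErrorModel.consistency (h : IsErrorModel P ε σ) (hσ : 0 < σ) (ν : Profile K)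
    {n : ℕ → Pair K → ℕ} (hn : ∀ e, Tendsto (fun m => n m e) atTop atTop)
    (rule : MultipleTesting) {lin : Finset (Triad K) → Finset (Triad K)} (hlin : IsBasisChoice lin)
    {α : ℝ} (h0 : 0 < α) (h1 : α < 1) :
    Tendsto (fun m => P.real {ω |
      cyclicPart ν ∈ modelSpan (ftbs rule lin α (n m) (outcomes ν ε ω))}) atTop (𝓝 1) := by
  refine tendsto_measureReal_one_of_ae_eventually ?_
  rcases isEmpty_or_nonempty (Pair K) with hK | hK
  · refine ae_of_all _ fun ω => Eventually.of_forall fun m => ?_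
    rw [Subsingleton.elim (cyclicPart ν) 0]
    exact Submodule.zero_mem _
  obtain ⟨δ, hδ, hmem⟩ := exists_cyclicPart_mem_ftbs rule hlin h0 h1 ν
  filter_upwards [h.ae_eventually_norm_le ν hn hδ, h.ae_eventually_varEst hσ ν hn] with ω h2 h3
  have hN : 0 < 2 * σ ^ 2 / δ := by positivity
  have h4 : ∀ᶠ m in atTop, ∀ e, 2 * σ ^ 2 / δ ≤ n m e := eventually_all.2 fun e =>
    (tendsto_natCast_atTop_atTop.comp (hn e)).eventually_ge_atTop _
  filter_upwards [h2, h3, h4] with m h2 h3 h4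
  refine hmem _ _ _ hN h4 h2 (h3.2.trans (le_of_eq ?_))
  field_simp

/-- The event on which all false null hypotheses are rejected has exponentially small
complement. -/
theorem IsErrorModel.exponential_consistency (h : IsErrorModel P ε σ) (ν : Profile K)
    {n : ℕ → Pair K → ℕ} (hn : ∀ e, Tendsto (fun m => n m e) atTop atTop)
    (rule : MultipleTesting) {lin : Finset (Triad K) → Finset (Triad K)} (hlin : IsBasisChoice lin)
    {α : ℝ} (h0 : 0 < α) (h1 : α < 1) {c : ℝ} (hc : 0 < c)
    (hcn : ∀ᶠ m in atTop, ∀ e, c * (total (n m) : ℝ) ≤ (n m e : ℝ)) {τ : ℝ≥0}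
    (hτ : ∀ e k, HasSubgaussianMGF (ε e k) τ P) :
    ∃ C₁ C₂ : ℝ, 0 < C₁ ∧ 0 < C₂ ∧ ∀ m,
      1 - C₁ * Real.exp (-(C₂ * (total (n m) : ℝ))) ≤
        P.real {ω | cyclicPart ν ∈ modelSpan (ftbs rule lin α (n m) (outcomes ν ε ω))} := by
  rcases isEmpty_or_nonempty (Pair K) with hK | hK
  · refine ⟨1, 1, one_pos, one_pos, fun m => ?_⟩
    have : {ω | cyclicPart ν ∈ modelSpan (ftbs rule lin α (n m) (outcomes ν ε ω))} = Set.univ := by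
      refine Set.eq_univ_of_forall fun ω => ?_
      rw [Set.mem_ofPred_eq, Subsingleton.elim (cyclicPart ν) 0]
      exact Submodule.zero_mem _
    rw [this, probReal_univ]
    linarith [Real.exp_pos (-(1 * (total (n m) : ℝ)))]
  obtain ⟨δ, hδ, hmem⟩ := exists_cyclicPart_mem_ftbs rule hlin h0 h1 ν
  obtain ⟨C₁, C₂, hC₁, hC₂, hb⟩ := h.exponential_bound ν hτ hc hδ
  have hpos : ∀ᶠ m in atTop, ∀ e, 0 < n m e :=
    eventually_all.2 fun e => (hn e).eventually_gt_atTop 0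
  obtain ⟨m₀, hm₀⟩ := eventually_atTop.1 (hcn.and hpos)
  -- The finitely many stages before `m₀` are covered by a larger constant.
  set C := ∑ m ∈ Finset.range m₀, Real.exp (C₂ * (total (n m) : ℝ)) with hC
  have hC0 : 0 ≤ C := Finset.sum_nonneg fun _ _ => (Real.exp_pos _).le
  refine ⟨C₁ + C, C₂, by positivity, hC₂, fun m => ?_⟩
  rcases lt_or_ge m m₀ with hm | hm
  · have h2 : Real.exp (C₂ * (total (n m) : ℝ)) ≤ C₁ + C := by
      have := Finset.single_le_sum (f := fun m => Real.exp (C₂ * (total (n m) : ℝ)))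
        (fun _ _ => (Real.exp_pos _).le) (Finset.mem_range.2 hm)
      linarith
    have h3 : 1 ≤ (C₁ + C) * Real.exp (-(C₂ * (total (n m) : ℝ))) := by
      rw [Real.exp_neg, ← div_eq_mul_inv, le_div_iff₀ (Real.exp_pos _), one_mul]
      exact h2
    linarith [measureReal_nonneg (μ := P)
      (s := {ω | cyclicPart ν ∈ modelSpan (ftbs rule lin α (n m) (outcomes ν ε ω))})]
  · obtain ⟨h2, h3⟩ := hm₀ m hm
    refine le_trans ?_ (one_sub_le_measureReal _)
    have h4 : P.real {ω | cyclicPart ν ∈ modelSpan (ftbs rule lin α (n m) (outcomes ν ε ω))}ᶜ ≤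
        C₁ * Real.exp (-(C₂ * (total (n m) : ℝ))) := by
      refine le_trans (measureReal_mono (Set.compl_subset_compl.2 ?_) (measure_ne_top _ _))
        (hb (n m) h3 h2)
      intro ω hω
      exact hmem _ _ _ (mul_pos hc (total_pos h3)) h2 hω.1 hω.2
    have h5 : C₁ * Real.exp (-(C₂ * (total (n m) : ℝ))) ≤
        (C₁ + C) * Real.exp (-(C₂ * (total (n m) : ℝ))) := by
      gcongr; linarith
    linarith

/-- At levels tending to zero, tests of true null hypotheses stop rejecting, since their p-values
are bounded away from zero in probability. -/
theorem IsErrorModel.exact_recovery (h : IsErrorModel P ε σ) (hσ : 0 < σ) (ν : Profile K)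
    {n : ℕ → Pair K → ℕ} (hn : ∀ e, Tendsto (fun m => n m e) atTop atTop)
    (rule : MultipleTesting) {lin : Finset (Triad K) → Finset (Triad K)} (hlin : IsBasisChoice lin)
    {α : ℕ → ℝ} (hα : ∀ m, 0 < α m ∧ α m < 1) (hα0 : Tendsto α atTop (𝓝 0))
    (hpair : ∀ e, cyclicPart ν e ≠ 0 →
      Tendsto (fun m => P.real {ω |
        rule.Rejects (α m) (pairPValue (n m) (outcomes ν ε ω)) e}) atTop (𝓝 1))
    (hfit : ∀ T : Finset (Triad K), ν ∉ modelSpan T →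
      Tendsto (fun m => P.real {ω |
        LackOfFitRejects (α m) (n m) (modelSpan T) (outcomes ν ε ω)}) atTop (𝓝 1))
    {γ : Triad K → ℝ} (hγ : IsMinimalModel γ ν)
    (hdis : ∀ t ∈ modelTriads γ, ∀ u ∈ modelTriads γ, t ≠ u → (t.items ∩ u.items).card ≤ 1)
    (hcl : ∀ t : Triad K, (∀ e ∈ t.pairs, ∃ u ∈ modelTriads γ, e ∈ u.pairs) →
      t ∈ modelTriads γ) :
    Tendsto (fun m => P.real {ω |
        modelSpan (ftbs rule lin (α m) (n m) (outcomes ν ε ω)) = trueModel ν ∧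
        ftbs rule lin (α m) (n m) (outcomes ν ε ω) = modelTriads γ}) atTop (𝓝 1) := by
  rcases isEmpty_or_nonempty (Pair K) with hK | hK
  · refine tendsto_measureReal_one_of_ae_eventually
      (ae_of_all _ fun ω => Eventually.of_forall fun m => ⟨?_, ?_⟩)
    · exact Subsingleton.elim _ _
    · have : IsEmpty (Triad K) := ⟨fun t => hK.false ⟨(t.1.1, t.1.2.1), t.2.1⟩⟩
      exact Subsingleton.elim _ _
  have hae := h.aemeasurable_outcomes ν
  -- Complements of the three kinds of events that have probability tending to one.
  let A : Pair K → ℕ → Set Ω := fun e m => {ω | cyclicPart ν e ≠ 0 →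
    rule.Rejects (α m) (pairPValue (n m) (outcomes ν ε ω)) e}ᶜ
  let B : Finset (Triad K) → ℕ → Set Ω := fun T m => {ω | ν ∉ modelSpan T →
    LackOfFitRejects (α m) (n m) (modelSpan T) (outcomes ν ε ω)}ᶜ
  let V : ℕ → Set Ω := fun m => {ω | σ ^ 2 / 2 ≤ varEst (n m) (outcomes ν ε ω)}ᶜ
  have hA : ∀ e, Tendsto (fun m => P.real (A e m)) atTop (𝓝 0) := by
    intro e
    by_cases he : cyclicPart ν e ≠ 0
    · simp only [A, he, ne_eq, not_false_eq_true, forall_const]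
      exact tendsto_measureReal_compl (fun m => hae.nullMeasurableSet_preimage
        (measurableSet_rejects rule (α m) (n m) e)) (hpair e he)
    · simp [A, he]
  have hB : ∀ T, Tendsto (fun m => P.real (B T m)) atTop (𝓝 0) := by
    intro T
    by_cases hT : ν ∉ modelSpan T
    · simp only [B, hT, not_false_eq_true, forall_const]
      exact tendsto_measureReal_compl (fun m => hae.nullMeasurableSet_preimage
        (measurableSet_lackOfFitRejects (α m) (n m) (modelSpan T))) (hfit T hT)
    · simp [B, hT]
  have hV : Tendsto (fun m => P.real (V m)) atTop (𝓝 0) := by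
    refine tendsto_measureReal_compl (fun m => hae.nullMeasurableSet_preimage
      (measurableSet_le measurable_const (measurable_varEst (n m)))) ?_
    refine tendsto_measureReal_one_of_ae_eventually ?_
    filter_upwards [h.ae_eventually_varEst hσ ν hn] with ω hω
    exact hω.mono fun m hm => hm.1
  have hsum : Tendsto (fun m => ∑ e, P.real (A e m) + ∑ T, P.real (B T m) + P.real (V m))
      atTop (𝓝 0) := by
    simpa using ((tendsto_finsetSum _ fun e _ => hA e).add
      (tendsto_finsetSum _ fun T _ => hB T)).add hV
  refine tendsto_order.2 ⟨fun a ha => ?_, fun a ha => Eventually.of_forall fun m =>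
    lt_of_le_of_lt measureReal_le_one ha⟩
  set η := 1 - a with hη
  have hη0 : 0 < η := by linarith
  -- A bound that `noiseEnergy` exceeds with probability at most `η / 2`.
  set p : ℝ := (Fintype.card (Pair K) : ℝ) * σ ^ 2 with hp
  have hp0 : 0 < p := mul_pos (by exact_mod_cast Fintype.card_pos) (by positivity)
  set M : ℝ := 2 * p / η with hM
  have hM0 : 0 < M := by positivity
  have hs : 0 < σ ^ 2 / 2 := by positivity
  have hpos : ∀ᶠ m in atTop, ∀ e, 0 < n m e :=
    eventually_all.2 fun e => (hn e).eventually_gt_atTop 0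
  filter_upwards [hpos, hα0.eventually (gt_mem_nhds (chiSqTail_pos (M / (σ ^ 2 / 2)))),
    hsum.eventually (gt_mem_nhds (half_pos hη0))] with m hm hαm hsm
  set G := {ω | modelSpan (ftbs rule lin (α m) (n m) (outcomes ν ε ω)) = trueModel ν ∧
        ftbs rule lin (α m) (n m) (outcomes ν ε ω) = modelTriads γ} with hG
  let W : Set Ω := {ω | M ≤ noiseEnergy (n m) ν (outcomes ν ε ω)}
  have hsub : Gᶜ ⊆ (((⋃ e, A e m) ∪ ⋃ T, B T m) ∪ V m) ∪ W := by
    intro ω hω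
    by_contra hnot
    simp only [Set.mem_union, Set.mem_iUnion, not_or, not_exists, A, B, V, W,
      Set.mem_compl_iff, not_not, Set.mem_ofPred_eq, not_le] at hnot
    obtain ⟨⟨⟨h1, h2⟩, h3⟩, h4⟩ := hnot
    have heq : ftbs rule lin (α m) (n m) (outcomes ν ε ω) = modelTriads γ := by
      refine ftbs_eq_modelTriads hlin (hα m).1 (hα m).2 (fun e => ⟨fun hr he => ?_, h1 e⟩)
        (fun T => ⟨fun hr hT => ?_, h2 T⟩) hγ hdis hcl
      · exact absurd ((chiSqTail_le_pairPValue hs hm h4.le (not_lt.1 h3) he).trans_lt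
          (hr.lt (hα m).1))
          hαm.not_gt
      · exact absurd ((chiSqTail_le_lackOfFitPValue hs hm hT h4.le (not_lt.1 h3)).trans hr)
          hαm.not_ge
    exact hω ⟨by rw [heq, modelSpan_eq_trueModel hγ hdis hcl], heq⟩
  have hW : P.real W ≤ η / 2 := by
    refine (h.noiseEnergy_tail ν hm hM0).trans (le_of_eq ?_)
    rw [← hp, hM]
    field_simp
  have h1 : P.real Gᶜ < η := by
    calc P.real Gᶜ ≤ P.real ((((⋃ e, A e m) ∪ ⋃ T, B T m) ∪ V m) ∪ W) :=
          measureReal_mono hsub (measure_ne_top _ _)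
      _ ≤ P.real (⋃ e, A e m) + P.real (⋃ T, B T m) + P.real (V m) + P.real W :=
          (measureReal_union_le _ _).trans (add_le_add_left ((measureReal_union_le _ _).trans
            (add_le_add_left (measureReal_union_le _ _) _)) _)
      _ ≤ (∑ e, P.real (A e m) + ∑ T, P.real (B T m) + P.real (V m)) + η / 2 := by
          gcongr
          · exact measureReal_iUnion_fintype_le _
          · exact measureReal_iUnion_fintype_le _
      _ < η := by linarith
  linarith [one_sub_le_measureReal (P := P) G]

end

end PairedComparison

theorem mainTheorem1 {K : ℕ} (ν : Profile K)
    -- the errors: independent, identically distributed, mean zero, variance `σ ^ 2`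
    {Ω : Type*} [MeasurableSpace Ω] (P : Measure Ω) [IsProbabilityMeasure P]
    (ε : Pair K → ℕ → Ω → ℝ) (σ : ℝ) (hσ : 0 < σ)
    (h_indep : iIndepFun (fun q : Pair K × ℕ => ε q.1 q.2) P)
    (h_ident : ∀ q r : Pair K × ℕ, IdentDistrib (ε q.1 q.2) (ε r.1 r.2) P P)
    (h_sq : ∀ e k, MemLp (ε e k) 2 P)
    (h_mean : ∀ e k, ∫ ω, ε e k ω ∂P = 0)
    (h_var : ∀ e k, variance (ε e k) P = σ ^ 2)
    -- the numbers of comparisons `n m e` of the pairs `e`, at stage `m`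
    (n : ℕ → Pair K → ℕ) (hn : ∀ e, Tendsto (fun m => n m e) atTop atTop)
    -- the multiplicity adjustment and the choice of maximal linearly independent subsets
    (rule : MultipleTesting)
    (lin : Finset (Triad K) → Finset (Triad K)) (hlin : IsBasisChoice lin) :
    -- consistency at a fixed level
    (∀ α : ℝ, 0 < α → α < 1 →
      Tendsto (fun m => P.real {ω |
          cyclicPart ν ∈ modelSpan (ftbs rule lin α (n m) (outcomes ν ε ω))})
        atTop (𝓝 1)) ∧
    -- exponential rate for sub-Gaussian errors
    (∀ α : ℝ, 0 < α → α < 1 →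
      (∃ c : ℝ, 0 < c ∧ ∀ᶠ m in atTop, ∀ e, c * (total (n m) : ℝ) ≤ (n m e : ℝ)) →
      (∃ τ : ℝ≥0, ∀ e k, HasSubgaussianMGF (ε e k) τ P) →
      ∃ C₁ C₂ : ℝ, 0 < C₁ ∧ 0 < C₂ ∧ ∀ m,
        1 - C₁ * Real.exp (-(C₂ * (total (n m) : ℝ))) ≤
          P.real {ω | cyclicPart ν ∈ modelSpan (ftbs rule lin α (n m) (outcomes ν ε ω))}) ∧
    -- exact recovery
    (∀ α : ℕ → ℝ, (∀ m, 0 < α m ∧ α m < 1) → Tendsto α atTop (𝓝 0) →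
      (∀ e, cyclicPart ν e ≠ 0 →
        Tendsto (fun m => P.real {ω |
            rule.Rejects (α m) (pairPValue (n m) (outcomes ν ε ω)) e}) atTop (𝓝 1)) →
      (∀ T : Finset (Triad K), ν ∉ modelSpan T →
        Tendsto (fun m => P.real {ω |
            LackOfFitRejects (α m) (n m) (modelSpan T) (outcomes ν ε ω)}) atTop (𝓝 1)) →
      ∀ γ : Triad K → ℝ, IsMinimalModel γ ν →
        (∀ t ∈ modelTriads γ, ∀ u ∈ modelTriads γ, t ≠ u → (t.items ∩ u.items).card ≤ 1) →
        (∀ t : Triad K, (∀ e ∈ t.pairs, ∃ u ∈ modelTriads γ, e ∈ u.pairs) →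
          t ∈ modelTriads γ) →
        Tendsto (fun m => P.real {ω |
            modelSpan (ftbs rule lin (α m) (n m) (outcomes ν ε ω)) = trueModel ν ∧
            ftbs rule lin (α m) (n m) (outcomes ν ε ω) = modelTriads γ})
          atTop (𝓝 1)) := by
  have h : IsErrorModel P ε σ := ⟨h_indep, h_ident, h_sq, h_mean, h_var⟩
  refine ⟨fun α h0 h1 => h.consistency hσ ν hn rule hlin h0 h1, ?_, ?_⟩
  · rintro α h0 h1 ⟨c, hc, hcn⟩ ⟨τ, hτ⟩
    exact h.exponential_consistency ν hn rule hlin h0 h1 hc hcn hτ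
  · intro α hα hα0 hpair hfit γ hγ hdis hcl
    exact h.exact_recovery hσ ν hn rule hlin hα hα0 hpair hfit hγ hdis hcl
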